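/- Let $\mathcal H$ be a real Hilbert space, and let $\mathcal T:\mathcal H\to 2^{\mathcal H}$ be a maximal monotone operator with $\mathcal T^{-1}(0)\neq\emptyset$. Let $\mathcal M:\mathcal H\to\mathcal H$ be an admissible preconditioner for $\mathcal T$, i.e. a bounded, self-adjoint, positive semidefinite linear operator such that $\widehat{\mathcal T}:=(\mathcal M+\mathcal T)^{-1}\mathcal M$ is single-valued with full domain. Assume that $\mathcal M$ has closed range and that $(\mathcal M+\mathcal T)^{-1}$ is continuous, i.e. single-valued and norm-continuous on its domain. Let $\mathcal M=\mathcal C\mathcal C^*$, where $\mathcal C:\mathcal U\to\mathcal H$ is a bounded injective linear operator from a real Hilbert space $\mathcal U$. Let $\alpha\ge 2$, $\rho\in(0,2]$, $\hat w^0=w^0\in\mathcal H$, and let the sequences $\{w^k\}$, $\{\bar w^k\}$, $\{\hat w^k\}$ be generated by the accelerated degenerate proximal point method: for $k=0,1,2,\dots$, $$\bar w^k=\widehat{\mathcal T}w^k,\qquad \hat w^{k+1}=(1-\rho)w^k+\rho\,\bar w^k,$$ $$w^{k+1}=w^k+\frac{\alpha}{2(k+\alpha)}\bigl(\hat w^{k+1}-w^k\bigr)+\frac{k}{k+\alpha}\bigl(\hat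 w^{k+1}-\hat w^k\bigr).$$ Then the set $\mathcal C^*\mathcal T^{-1}(0)$ is closed and convex, and, with $\Pi_{\mathcal C^*\mathcal T^{-1}(0)}$ denoting the metric projection onto it, the following hold. (a) If $\alpha=2$, then $\{\bar w^k\}$ converges strongly to the point $$w^*=(\mathcal M+\mathcal T)^{-1}\mathcal C\,\Pi_{\mathcal C^*\mathcal T^{-1}(0)}(\mathcal C^*w^0),$$ which is well defined, is a fixed point of $\widehat{\mathcal T}$ and lies in $\mathcal T^{-1}(0)$. If moreover $\rho\in(0,2)$, then $\{w^k\}$ and $\{\hat w^k\}$ also converge strongly to $w^*$. (b) If $\alpha>2$, then $\{\bar w^k\}$ converges weakly to a fixed point of $\widehat{\mathcal T}$ lying in $\mathcal T^{-1}(0)$. -/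

import Mathlib

open Filter Topology

namespace DPPM

section SetValued

variable {H : Type*} [NormedAddCommGroup H] [InnerProductSpace ℝ H]

/-- A set-valued operator `T : H → 2^H` is monotone. -/
def IsMonotoneOp (T : H → Set H) : Prop :=
  ∀ ⦃w w' v v' : H⦄, v ∈ T w → v' ∈ T w' → 0 ≤ inner ℝ (v - v') (w - w')

/-- The graph of a set-valued operator. -/
def gph (T : H → Set H) : Set (H × H) := {x | x.2 ∈ T x.1}

/-- A maximal monotone operator: it is monotone and its graph is not properly contained in the
graph of another monotone operator. -/
def IsMaximalMonotoneOp (T : H → Set H) : Prop :=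
  IsMonotoneOp T ∧ ∀ T' : H → Set H, IsMonotoneOp T' → ¬ gph T ⊂ gph T'

/-- The inverse of a set-valued operator. -/
def inv (T : H → Set H) : H → Set H := fun v => {w | v ∈ T w}

/-- The set-valued operator `M + T`. -/
def addOp (M : H →L[ℝ] H) (T : H → Set H) : H → Set H := fun w => {y | ∃ v ∈ T w, y = M w + v}

/-- The set-valued operator `(M + T)⁻¹ M`. -/
def hatT (M : H →L[ℝ] H) (T : H → Set H) : H → Set H := fun w => inv (addOp M T) (M w)

/-- An admissible preconditioner: a bounded, self-adjoint, positive semidefinite linear operator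
such that `(M + T)⁻¹ M` is single-valued with full domain. -/
def IsAdmissible (M : H →L[ℝ] H) (T : H → Set H) : Prop :=
  M.IsPositive ∧ ∀ w : H, ∃! z : H, z ∈ hatT M T w

/-- The domain of a set-valued operator. -/
def dom (A : H → Set H) : Set H := {v | (A v).Nonempty}

/-- A set-valued operator is continuous: it is single-valued on its domain, and it is continuous
there (for the norm topology) as a function. -/
def IsContinuousOp (A : H → Set H) : Prop :=
  ∃ f : H → H, (∀ v ∈ dom A, A v = {f v}) ∧ ContinuousOn f (dom A)

/-- `p` is the (metric) projection of `x` onto the set `K`: the unique nearest point. -/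
def IsProjOnto (K : Set H) (x p : H) : Prop :=
  p ∈ K ∧ ∀ q ∈ K, q ≠ p → ‖x - p‖ < ‖x - q‖

/-- The sequences `w`, `wbar`, `what` are generated by the accelerated degenerate proximal point
method with parameters `α` and `ρ`. -/
structure IsAccDPPM (M : H →L[ℝ] H) (T : H → Set H) (α ρ : ℝ) (w wbar what : ℕ → H) : Prop where
  init : what 0 = w 0
  step1 : ∀ k, wbar k ∈ hatT M T (w k)
  step2 : ∀ k, what (k + 1) = (1 - ρ) • w k + ρ • wbar k
  step3 : ∀ k : ℕ, w (k + 1) = w k + (α / (2 * ((k : ℝ) + α))) • (what (k + 1) - w k)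
    + ((k : ℝ) / ((k : ℝ) + α)) • (what (k + 1) - what k)

/-- Weak convergence of a sequence. -/
def WeaklyConvergesTo (x : ℕ → H) (a : H) : Prop :=
  Tendsto (fun k => toWeakSpace ℝ H (x k)) atTop (𝓝 (toWeakSpace ℝ H a))

end SetValued

end DPPM

/-!
Write `g u = (M + T)⁻¹ (C u)`. Since `M = C C*` has closed range and `C` is injective, `C*` is
onto, so `g` is defined on all of `U`, and monotonicity of `T` makes `J = C* g` firmly
nonexpansive. Hence `Q = ρ (id - J)` is `½`-cocoercive, its zero set is `C* T⁻¹(0)`, an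
intersection of half-spaces, and `x k = C* (w k)` follows an accelerated iteration for a zero of
`Q`, with `wbar k = g (x k)`. In terms of the momentum `y k = k (x k - x̂ k)`, where `x̂ k` is the
image under `C*` of `what k`, the iteration reads

  `y (k + 1) = (k + 1) / (k + α) (y k + (α / 2) Q (x k))`,
  `x (k + 1) - x k = y (k + 1) / (k + 1) - Q (x k)`.

* For `α = 2` the sum `x k + y k` is constant, i.e. the iteration is Halpern's. The residual is
  `O(1 / k)` (`IsMomentumIter.lieder`), and demiclosedness of `Q` gives strong convergence to the
  projection of `x 0` (`IsMomentumIter.tendsto_halpern`). Continuity of `g` transfers this to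
  `wbar`; for `ρ < 2` the recursion for `w` itself is a contraction, up to an error that vanishes.
* For `α > 2` a Lyapunov function, affine in a parameter, decreases for two values of the parameter
  (`IsMomentumIter.eventually_energy_add_le`). This makes `Q (x k)` and `y k` vanish and
  `‖x k - p‖` converge for every zero `p` of `Q`, so Opial's lemma yields a weak limit `q` of `x`.

A norm-continuous map need not preserve weak convergence, nor bounded sets, so the weak convergence
of `wbar k = g (x k)` to `g q` takes a further argument. By Minty's theorem, proved by minimising
the Fitzpatrick function plus a square, `M + ε + T` is onto; letting `ε → 0` shows that the domain
of `(M + T)⁻¹` contains a ball around `M z₀` for `z₀ ∈ T⁻¹(0)`, on which `(M + T)⁻¹` is bounded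
(`exists_ball_subset_dom`). Monotonicity against the values on this ball bounds `wbar`
(`exists_norm_le_of_bounded`). A weak cluster point `z` of `wbar` then satisfies `0 ∈ T z` and
`C* z = q`, and `g q` is the only such point.

Weak compactness is used along ultrafilters rather than through subsequences.
-/

namespace DPPM

/-! ### Weak limits along filters -/

section WeakLimits

variable {ι E : Type*} [NormedAddCommGroup E] [InnerProductSpace ℝ E]

/-- Weak convergence along a filter in an inner product space, tested against inner products. -/
def WeakLim (F : Filter ι) (x : ι → E) (q : E) : Prop :=
  ∀ h : E, Tendsto (fun i => inner ℝ (x i) h) F (𝓝 (inner ℝ q h))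

/-- Weak sequential compactness of balls, in the form needed here: by the Banach–Alaoglu theorem,
a bounded family converges weakly along every ultrafilter. -/
lemma exists_weakLim_of_bounded [CompleteSpace E] (F : Ultrafilter ι) {x : ι → E} {R : ℝ}
    (hx : ∀ i, ‖x i‖ ≤ R) : ∃ q, WeakLim (F : Filter ι) x q := by
  have hc := WeakDual.isCompact_closedBall (𝕜 := ℝ) (E := E) 0 R
  rw [isCompact_iff_ultrafilter_le_nhds] at hc
  let f : ι → WeakDual ℝ E := fun i => StrongDual.toWeakDual (InnerProductSpace.toDual ℝ E (x i))
  obtain ⟨φ, -, hφ⟩ := hc (F.map f) (by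
    rw [le_principal_iff, Ultrafilter.mem_coe, Ultrafilter.mem_map]
    refine Filter.univ_mem' fun i => ?_
    simpa [f] using hx i)
  refine ⟨(InnerProductSpace.toDual ℝ E).symm (WeakDual.toStrongDual φ), fun h => ?_⟩
  have h1 : Tendsto f F (𝓝 φ) := hφ
  have h2 := ((WeakDual.eval_continuous (𝕜 := ℝ) (E := E) h).tendsto φ).comp h1
  rw [InnerProductSpace.toDual_symm_apply]
  exact h2

lemma WeakLim.mono {F G : Filter ι} {x : ι → E} {q : E} (h : WeakLim F x q) (hGF : G ≤ F) :
    WeakLim G x q := fun y => (h y).mono_left hGF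

lemma WeakLim.unique {F : Filter ι} [F.NeBot] {x : ι → E} {p q : E} (hp : WeakLim F x p)
    (hq : WeakLim F x q) : p = q :=
  ext_inner_right ℝ fun h => tendsto_nhds_unique (hp h) (hq h)

lemma WeakLim.map [CompleteSpace E] {G : Type*} [NormedAddCommGroup G] [InnerProductSpace ℝ G]
    [CompleteSpace G] {F : Filter ι} {x : ι → E} {q : E} (h : WeakLim F x q) (L : E →L[ℝ] G) :
    WeakLim F (fun i => L (x i)) (L q) := by
  intro y
  simpa only [ContinuousLinearMap.adjoint_inner_right] using
    h (ContinuousLinearMap.adjoint L y)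

lemma WeakLim.add_strong {F : Filter ι} {x y : ι → E} {q r : E} (h : WeakLim F x q)
    (hy : Tendsto y F (𝓝 r)) : WeakLim F (fun i => x i + y i) (q + r) := by
  intro z
  simp only [inner_add_left]
  exact (h z).add (hy.inner tendsto_const_nhds)

/-- The inner product of a bounded weakly convergent family with a strongly convergent one
converges. -/
lemma WeakLim.inner_strong {F : Filter ι} {x y : ι → E} {q r : E} (h : WeakLim F x q) {R : ℝ}
    (hR : ∀ i, ‖x i‖ ≤ R) (hy : Tendsto y F (𝓝 r)) :
    Tendsto (fun i => inner ℝ (x i) (y i)) F (𝓝 (inner ℝ q r)) := by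
  have h1 : Tendsto (fun i => inner ℝ (x i) (y i - r)) F (𝓝 0) := by
    have h2 : Tendsto (fun i => R * ‖y i - r‖) F (𝓝 0) := by
      simpa using ((tendsto_iff_norm_sub_tendsto_zero.1 hy).const_mul R)
    refine squeeze_zero_norm (fun i => ?_) h2
    exact (norm_inner_le_norm _ _).trans (mul_le_mul_of_nonneg_right (hR i) (norm_nonneg _))
  have := h1.add (h r)
  simpa [inner_sub_right] using this

lemma weaklyConvergesTo_of_weakLim [CompleteSpace E] {x : ℕ → E} {a : E}
    (h : WeakLim atTop x a) : WeaklyConvergesTo x a := by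
  unfold WeaklyConvergesTo
  refine (WeakBilin.tendsto_iff_forall_eval_tendsto (B := (topDualPairing ℝ E).flip) ?_).2 ?_
  · intro u v huv
    refine ext_inner_left ℝ fun z => ?_
    have := LinearMap.congr_fun huv (InnerProductSpace.toDual ℝ E z)
    simpa using this
  · intro φ
    have e : ∀ y : E, inner ℝ y ((InnerProductSpace.toDual ℝ E).symm φ) = φ y := fun y => by
      rw [real_inner_comm, InnerProductSpace.toDual_symm_apply]
    have h1 := h ((InnerProductSpace.toDual ℝ E).symm φ)
    rw [e, funext fun k => e (x k)] at h1
    exact h1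

/-- A family converges weakly to `q` as soon as it does so along every finer ultrafilter. -/
lemma weakLim_of_ultrafilter {F : Filter ι} {x : ι → E} {q : E}
    (h : ∀ G : Ultrafilter ι, (G : Filter ι) ≤ F → WeakLim (G : Filter ι) x q) :
    WeakLim F x q := fun y =>
  (tendsto_iff_ultrafilter _ _ _).2 fun G hG => h G hG y

/-- Opial's lemma: a bounded sequence whose distance to each point of `S` converges, and whose weak
cluster points lie in `S`, converges weakly to a point of `S`. -/
lemma exists_weakLim_of_opial [CompleteSpace E] {x : ℕ → E} {S : Set E} {R : ℝ}
    (hR : ∀ k, ‖x k‖ ≤ R)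
    (hdist : ∀ s ∈ S, ∃ l, Tendsto (fun k => ‖x k - s‖ ^ 2) atTop (𝓝 l))
    (hclus : ∀ (G : Ultrafilter ℕ) (q : E), (G : Filter ℕ) ≤ atTop → WeakLim (G : Filter ℕ) x q →
      q ∈ S) :
    ∃ q ∈ S, WeakLim atTop x q := by
  obtain ⟨q, hq⟩ := exists_weakLim_of_bounded (hyperfilter ℕ) hR
  have hle : (hyperfilter ℕ : Filter ℕ) ≤ atTop := Nat.hyperfilter_le_atTop
  have hqS := hclus _ q hle hq
  refine ⟨q, hqS, weakLim_of_ultrafilter fun G hG => ?_⟩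
  obtain ⟨r, hr⟩ := exists_weakLim_of_bounded G hR
  have hrS := hclus _ r hG hr
  obtain ⟨l₁, h₁⟩ := hdist q hqS
  obtain ⟨l₂, h₂⟩ := hdist r hrS
  -- `⟪x k, r - q⟫` is an affine function of the difference of the squared distances
  have key : ∀ k, inner ℝ (x k) (r - q)
      = (‖x k - q‖ ^ 2 - ‖x k - r‖ ^ 2 + ‖r‖ ^ 2 - ‖q‖ ^ 2) / 2 := by
    intro k
    rw [norm_sub_sq_real, norm_sub_sq_real, inner_sub_right]
    ring
  have hlim : Tendsto (fun k => inner ℝ (x k) (r - q)) atTop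
      (𝓝 ((l₁ - l₂ + ‖r‖ ^ 2 - ‖q‖ ^ 2) / 2)) := by
    simp only [key]
    exact ((((h₁.sub h₂).add_const _).sub_const _).div_const _)
  have e₁ := tendsto_nhds_unique (hq (r - q)) (hlim.mono_left hle)
  have e₂ := tendsto_nhds_unique (hr (r - q)) (hlim.mono_left hG)
  have h0 : inner ℝ (r - q) (r - q) = 0 := by
    rw [inner_sub_left, e₁, e₂, sub_self]
  have : r = q := sub_eq_zero.1 (inner_self_eq_zero.1 h0)
  exact this ▸ hr

end WeakLimits

/-! ### Maximal monotone operators and the theorem of Minty -/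

section Monotone

variable {H : Type*} [NormedAddCommGroup H] [InnerProductSpace ℝ H]

/-- The usual form of maximality: a pair monotonically related to the whole graph is in it. -/
lemma IsMaximalMonotoneOp.mem_of_related {T : H → Set H} (hT : IsMaximalMonotoneOp T) {w v : H}
    (h : ∀ a t, t ∈ T a → 0 ≤ inner ℝ (t - v) (a - w)) : v ∈ T w := by
  by_contra hv
  refine hT.2 (fun a => {t | t ∈ T a ∨ (a = w ∧ t = v)}) ?_ ?_
  · rintro a a' t t' (ht | ⟨rfl, rfl⟩) (ht' | ⟨rfl, rfl⟩)
    · exact hT.1 ht ht'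
    · exact h _ _ ht
    · rw [← neg_sub t', ← neg_sub a', inner_neg_neg]
      exact h _ _ ht'
    · simp
  · refine ⟨fun x hx => Or.inl hx, fun hsub => hv ?_⟩
    have : ((w, v) : H × H) ∈ gph T := hsub (Or.inr ⟨rfl, rfl⟩)
    exact this

lemma IsMaximalMonotoneOp.nonempty_gph {T : H → Set H} (hT : IsMaximalMonotoneOp T) :
    ∃ a t, t ∈ T a := by
  by_contra h
  push Not at h
  exact h 0 0 (hT.mem_of_related fun a t ht => absurd ht (h a t))

/-- The graph of `M + T` is closed for weak convergence of the arguments (along a bounded family)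
and strong convergence of the values. -/
lemma IsMaximalMonotoneOp.sub_mem_of_weakLim [CompleteSpace H] {T : H → Set H}
    (hT : IsMaximalMonotoneOp T) {M : H →L[ℝ] H} (hM : M.IsPositive) {ι : Type*} {F : Filter ι}
    [F.NeBot] {z v : ι → H} {q r : H} {R : ℝ} (hR : ∀ i, ‖z i‖ ≤ R) (hz : WeakLim F z q)
    (hv : Tendsto v F (𝓝 r)) (hmem : ∀ i, v i - M (z i) ∈ T (z i)) : r - M q ∈ T q := by
  refine hT.mem_of_related fun a t ht => ?_
  have hsymm : ∀ x y, inner ℝ (M x) y = inner ℝ x (M y) := hM.isSymmetric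
  -- `⟪M z, z⟫ ≥ 2 ⟪M z, q⟫ - ⟪M q, q⟫` replaces weak lower semicontinuity
  have hge : ∀ i, 0 ≤ inner ℝ (t - v i) a - inner ℝ (z i) (t - v i) +
      (inner ℝ (z i) (M a) - 2 * inner ℝ (z i) (M q) + inner ℝ (M q) q) := by
    intro i
    have h1 := hT.1 ht (hmem i)
    have h2 : 0 ≤ inner ℝ (M (z i - q)) (z i - q) := hM.inner_nonneg_left _
    have h3 : inner ℝ (M (z i)) a = inner ℝ (z i) (M a) := hsymm _ _
    have h4 : inner ℝ (M (z i)) q = inner ℝ (z i) (M q) := hsymm _ _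
    have h5 : inner ℝ (M q) (z i) = inner ℝ (z i) (M q) := real_inner_comm _ _
    have h6 : inner ℝ (z i) (t - v i) = inner ℝ (t - v i) (z i) := real_inner_comm _ _
    have h7 : t - (v i - M (z i)) = (t - v i) + M (z i) := by abel
    rw [h7, inner_add_left, inner_sub_right, inner_sub_right] at h1
    rw [map_sub, inner_sub_left, inner_sub_right, inner_sub_right] at h2
    linarith
  have hlim : Tendsto (fun i => inner ℝ (t - v i) a - inner ℝ (z i) (t - v i) +
      (inner ℝ (z i) (M a) - 2 * inner ℝ (z i) (M q) + inner ℝ (M q) q)) F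
      (𝓝 (inner ℝ (t - r) a - inner ℝ q (t - r) +
      (inner ℝ q (M a) - 2 * inner ℝ q (M q) + inner ℝ (M q) q))) := by
    have htv : Tendsto (fun i => t - v i) F (𝓝 (t - r)) := tendsto_const_nhds.sub hv
    exact ((htv.inner tendsto_const_nhds).sub (hz.inner_strong hR htv)).add
      (((hz _).sub ((hz _).const_mul 2)).add_const _)
  have h0 := ge_of_tendsto' hlim hge
  have h3 : inner ℝ (M q) a = inner ℝ q (M a) := hsymm _ _
  have h5 : inner ℝ (M q) q = inner ℝ q (M q) := hsymm _ _
  have h6 : inner ℝ q (t - r) = inner ℝ (t - r) q := real_inner_comm _ _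
  have h7 : t - (r - M q) = (t - r) + M q := by abel
  rw [h7, inner_add_left, inner_sub_right, inner_sub_right]
  linarith

/-- A nonempty supremum of affine functions plus `½‖x‖²` attains its infimum if it is bounded
below. The supremum `Φ` enters through its epigraph `{(x, s) | ∀ i, ⟪b i, x⟫ - c i ≤ s}`; the
minimiser `(a, σ)` comes with the variational inequality `-a ∈ ∂Φ(a)`. -/
lemma exists_minimiser_sup_affine {X ι : Type*} [NormedAddCommGroup X] [InnerProductSpace ℝ X]
    [CompleteSpace X] (b : ι → X) (c : ι → ℝ)
    (hne : ∃ x s, ∀ i, inner ℝ (b i) x - c i ≤ s)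
    (hbdd : ∀ x s, (∀ i, inner ℝ (b i) x - c i ≤ s) → 0 ≤ ‖x‖ ^ 2 / 2 + s) :
    ∃ a σ, (∀ i, inner ℝ (b i) a - c i ≤ σ) ∧
      ∀ y s, (∀ i, inner ℝ (b i) y - c i ≤ s) → σ - inner ℝ a (y - a) ≤ s := by
  let E : Set (X × ℝ) := {p | ∀ i, inner ℝ (b i) p.1 - c i ≤ p.2}
  let V : Set ℝ := (fun p : X × ℝ => ‖p.1‖ ^ 2 / 2 + p.2) '' E
  have hVne : V.Nonempty := by
    obtain ⟨x, s, h⟩ := hne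
    exact ⟨_, (x, s), h, rfl⟩
  have hVbdd : BddBelow V := by
    refine ⟨0, ?_⟩
    rintro _ ⟨p, hp, rfl⟩
    exact hbdd _ _ hp
  set m := sInf V with hm
  have hmle : ∀ x s, (∀ i, inner ℝ (b i) x - c i ≤ s) → m ≤ ‖x‖ ^ 2 / 2 + s := fun x s h =>
    csInf_le hVbdd ⟨(x, s), h, rfl⟩
  have happrox : ∀ n : ℕ, ∃ p : X × ℝ, p ∈ E ∧ ‖p.1‖ ^ 2 / 2 + p.2 < m + 1 / ((n : ℝ) + 1) := by
    intro n
    obtain ⟨_, ⟨p, hp, rfl⟩, hlt⟩ := exists_lt_of_csInf_lt hVne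
      (show sInf V < m + 1 / ((n : ℝ) + 1) by
        rw [← hm]; linarith [Nat.one_div_pos_of_nat (α := ℝ) (n := n)])
    exact ⟨p, hp, hlt⟩
  choose p hpE hplt using happrox
  -- the value at a midpoint shows that a minimising sequence is Cauchy
  have hmid : ∀ n k, ‖(p n).1 - (p k).1‖ ^ 2 ≤ 4 * (1 / ((n : ℝ) + 1) + 1 / ((k : ℝ) + 1)) := by
    intro n k
    have h1 := hmle ((1 / 2 : ℝ) • ((p n).1 + (p k).1)) (((p n).2 + (p k).2) / 2) (by
      intro i
      have h1 := hpE n i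
      have h2 := hpE k i
      rw [inner_smul_right, inner_add_right]
      linarith)
    rw [norm_smul, mul_pow] at h1
    have h2 := parallelogram_law_with_norm ℝ (p n).1 (p k).1
    have h3 := hplt n
    have h4 := hplt k
    norm_num at h1
    nlinarith
  have hone : Tendsto (fun n : ℕ => 1 / ((n : ℝ) + 1)) atTop (𝓝 0) :=
    tendsto_one_div_add_atTop_nhds_zero_nat
  have hcau : CauchySeq fun n => (p n).1 := by
    rw [Metric.cauchySeq_iff']
    intro ε hε
    obtain ⟨N, hN⟩ := ((tendsto_order.1 hone).2 (ε ^ 2 / 8) (by positivity)).exists_forall_of_atTop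
    refine ⟨N, fun n hn => ?_⟩
    rw [dist_eq_norm]
    have h1 := hmid n N
    have h2 := hN n hn
    have h3 := hN N le_rfl
    exact lt_of_pow_lt_pow_left₀ 2 hε.le (by linarith)
  obtain ⟨a, ha⟩ := cauchySeq_tendsto_of_complete hcau
  have haE : ∀ i, inner ℝ (b i) a - c i ≤ m - ‖a‖ ^ 2 / 2 := by
    intro i
    refine le_of_tendsto_of_tendsto' ((tendsto_const_nhds.inner ha).sub_const _)
      (g := fun n : ℕ => m + 1 / ((n : ℝ) + 1) - ‖(p n).1‖ ^ 2 / 2) ?_ ?_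
    · simpa using (hone.const_add m).sub ((ha.norm.pow 2).div_const 2)
    · intro n
      have h1 := hpE n i
      have h2 := hplt n
      linarith
  refine ⟨a, m - ‖a‖ ^ 2 / 2, haE, fun y s hy => ?_⟩
  -- compare with the values on the segment from `a` to `y`, near `a`
  have hseg : ∀ t : ℝ, 0 < t → t ≤ 1 →
      0 ≤ inner ℝ a (y - a) + t * (‖y - a‖ ^ 2 / 2) + (s - (m - ‖a‖ ^ 2 / 2)) := by
    intro t ht ht1
    have h1 := hmle (a + t • (y - a)) ((m - ‖a‖ ^ 2 / 2) + t * (s - (m - ‖a‖ ^ 2 / 2))) (by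
      intro i
      have h2 := haE i
      have h3 := hy i
      rw [inner_add_right, inner_smul_right, inner_sub_right]
      nlinarith)
    rw [norm_add_sq_real, inner_smul_right, norm_smul, mul_pow, Real.norm_eq_abs, sq_abs] at h1
    refine nonneg_of_mul_nonneg_right (a := t) ?_ ht
    nlinarith
  have hlim : Tendsto (fun t : ℝ => inner ℝ a (y - a) + t * (‖y - a‖ ^ 2 / 2) +
      (s - (m - ‖a‖ ^ 2 / 2))) (𝓝[>] 0)
      (𝓝 (inner ℝ a (y - a) + 0 * (‖y - a‖ ^ 2 / 2) + (s - (m - ‖a‖ ^ 2 / 2)))) := by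
    refine Tendsto.mono_left ?_ nhdsWithin_le_nhds
    exact Continuous.tendsto (by fun_prop) 0
  have h0 := ge_of_tendsto hlim (by
    filter_upwards [Ioc_mem_nhdsGT (zero_lt_one' ℝ)] with t ht using hseg t ht.1 ht.2)
  linarith

/-- Minty's theorem at the point `0`. The function minimised is the Fitzpatrick function of `T`
plus `½(‖x‖² + ‖x'‖²)`; optimality of `(a, a')` says that `(-a', -a)` is monotonically related to
the graph of `T`, and then that `a' = -a`. -/
lemma IsMaximalMonotoneOp.exists_neg_mem [CompleteSpace H] {T : H → Set H}
    (hT : IsMaximalMonotoneOp T) : ∃ a, -a ∈ T a := by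
  let b : gph T → WithLp 2 (H × H) := fun i => WithLp.toLp 2 (i.1.2, i.1.1)
  let c : gph T → ℝ := fun i => inner ℝ i.1.1 i.1.2
  have hb : ∀ (i : gph T) (x : WithLp 2 (H × H)),
      inner ℝ (b i) x = inner ℝ i.1.2 x.fst + inner ℝ i.1.1 x.snd := by
    intro i x
    simp [b, WithLp.prod_inner_apply]
  have hmono : ∀ {y y' : H}, y' ∈ T y → ∀ i,
      inner ℝ (b i) (WithLp.toLp 2 (y, y')) - c i ≤ inner ℝ y y' := by
    intro y y' hy i
    have h := hT.1 i.2 hy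
    rw [hb]
    simp only [c]
    rw [inner_sub_left, inner_sub_right, inner_sub_right] at h
    have e1 : inner ℝ y' i.1.1 = inner ℝ i.1.1 y' := real_inner_comm _ _
    have e2 : inner ℝ y' y = inner ℝ y y' := real_inner_comm _ _
    have e3 : inner ℝ i.1.2 i.1.1 = inner ℝ i.1.1 i.1.2 := real_inner_comm _ _
    change inner ℝ i.1.2 y + inner ℝ i.1.1 y' - inner ℝ i.1.1 i.1.2 ≤ inner ℝ y y'
    linarith
  -- the Fitzpatrick function dominates the pairing
  have hfitz : ∀ (x : WithLp 2 (H × H)) (s : ℝ), (∀ i, inner ℝ (b i) x - c i ≤ s) →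
      inner ℝ x.fst x.snd ≤ s := by
    intro x s hs
    by_contra hlt
    push Not at hlt
    have hmem : x.snd ∈ T x.fst := hT.mem_of_related fun y y' hy => by
      have h := hs ⟨(y, y'), hy⟩
      rw [hb] at h
      simp only [c] at h
      have e2 : inner ℝ x.snd x.fst = inner ℝ x.fst x.snd := real_inner_comm _ _
      have e3 : inner ℝ y' y = inner ℝ y y' := real_inner_comm _ _
      have e4 : inner ℝ x.snd y = inner ℝ y x.snd := real_inner_comm _ _
      rw [inner_sub_left, inner_sub_right, inner_sub_right]
      linarith
    have h := hs ⟨(x.fst, x.snd), hmem⟩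
    rw [hb] at h
    simp only [c] at h
    have e2 : inner ℝ x.snd x.fst = inner ℝ x.fst x.snd := real_inner_comm _ _
    linarith
  have hsq : ∀ u v : H, ‖u + v‖ ^ 2 = ‖u‖ ^ 2 + 2 * inner ℝ u v + ‖v‖ ^ 2 := norm_add_sq_real
  obtain ⟨a, σ, haσ, hopt⟩ := exists_minimiser_sup_affine b c
    (by
      obtain ⟨y, y', hy⟩ := hT.nonempty_gph
      exact ⟨_, _, hmono hy⟩)
    (by
      intro x s hs
      have h1 := hfitz x s hs
      have h2 := hsq x.fst x.snd
      rw [WithLp.prod_norm_sq_eq_of_L2]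
      nlinarith [sq_nonneg ‖x.fst + x.snd‖])
  have hσ := hfitz a σ haσ
  have hrel : ∀ y y', y' ∈ T y →
      ‖a.fst + a.snd‖ ^ 2 ≤ inner ℝ (y' - -a.fst) (y - -a.snd) := by
    intro y y' hy
    have h := hopt _ _ (hmono hy)
    rw [inner_sub_right, real_inner_self_eq_norm_sq, WithLp.prod_norm_sq_eq_of_L2,
      WithLp.prod_inner_apply] at h
    simp only [sub_neg_eq_add] at h ⊢
    have h2 := hsq a.fst a.snd
    rw [inner_add_left, inner_add_right, inner_add_right]
    have e2 : inner ℝ y' y = inner ℝ y y' := real_inner_comm _ _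
    have e3 : inner ℝ y' a.snd = inner ℝ a.snd y' := real_inner_comm _ _
    have h3 : inner ℝ a.ofLp.1 y + inner ℝ a.ofLp.2 y' =
      inner ℝ a.fst y + inner ℝ a.snd y' := rfl
    linarith
  have hmem : -a.fst ∈ T (-a.snd) :=
    hT.mem_of_related fun y y' hy => (sq_nonneg _).trans (hrel y y' hy)
  have h0 := hrel _ _ hmem
  rw [sub_self, sub_self, inner_zero_left] at h0
  have h1 : a.fst + a.snd = 0 := norm_eq_zero.1 (pow_eq_zero_iff (two_ne_zero)|>.1
    (le_antisymm h0 (sq_nonneg _)))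
  refine ⟨a.fst, ?_⟩
  rw [eq_neg_of_add_eq_zero_right h1, neg_neg] at hmem
  exact hmem

/-- Minty's theorem for the scaled and shifted operator: `I + l T` is onto. -/
lemma IsMaximalMonotoneOp.exists_resolvent [CompleteSpace H] {T : H → Set H}
    (hT : IsMaximalMonotoneOp T) {l : ℝ} (hl : 0 < l) (v : H) :
    ∃ z, l⁻¹ • (v - z) ∈ T z := by
  -- apply `exists_neg_mem` to `z ↦ l T (z + v)`
  let S : H → Set H := fun z => {t | l⁻¹ • t ∈ T (z + v)}
  have hS : IsMaximalMonotoneOp S := by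
    constructor
    · intro z z' t t' ht ht'
      have h := hT.1 ht ht'
      rw [← smul_sub, add_sub_add_right_eq_sub, inner_smul_left] at h
      exact nonneg_of_mul_nonneg_right h (by simpa using hl)
    · rintro S' hS' ⟨hsub, hnot⟩
      refine hnot ?_
      rintro ⟨z, t⟩ hzt
      refine hT.mem_of_related (w := z + v) (v := l⁻¹ • t) fun y y' hy => ?_
      have hy' : ((y - v, l • y') : H × H) ∈ gph S := by
        change l⁻¹ • l • y' ∈ T (y - v + v)
        rwa [inv_smul_smul₀ hl.ne', sub_add_cancel]
      have h := hS' (hsub hy') hzt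
      have e1 : l • y' - t = l • (y' - l⁻¹ • t) := by rw [smul_sub, smul_inv_smul₀ hl.ne']
      have e2 : y - v - z = y - (z + v) := by abel
      simp only [e1, e2, inner_smul_left] at h
      exact nonneg_of_mul_nonneg_right h (by simpa using hl)
  obtain ⟨a, ha⟩ := hS.exists_neg_mem
  refine ⟨a + v, ?_⟩
  have : v - (a + v) = -a := by abel
  rw [this]
  exact ha

/-- `M + ε I + T` is onto: a solution of `v ∈ M z + ε z + T z` is a fixed point of
`z ↦ (I + l T)⁻¹ (z - l (M z + ε z - v))`, a contraction for small `l > 0`. -/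
lemma IsMaximalMonotoneOp.exists_regularized [CompleteSpace H] {T : H → Set H}
    (hT : IsMaximalMonotoneOp T) {M : H →L[ℝ] H} (hM : M.IsPositive) {ε : ℝ} (hε : 0 < ε) (v : H) :
    ∃ z, v - ε • z - M z ∈ T z := by
  set P : H →L[ℝ] H := M + ε • ContinuousLinearMap.id ℝ H with hP
  have hPz : ∀ z, P z = M z + ε • z := fun z => by simp [hP]
  have hPpos : ∀ z, ε * ‖z‖ ^ 2 ≤ inner ℝ (P z) z := by
    intro z
    have h : 0 ≤ inner ℝ (M z) z := hM.inner_nonneg_left z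
    rw [hPz, inner_add_left, real_inner_smul_left, real_inner_self_eq_norm_sq]
    linarith
  set B : ℝ := ‖P‖ ^ 2 + ε ^ 2 with hB
  have hBpos : 0 < B := by positivity
  -- minimises the bound `1 - 2 l ε + l² B` for the squared norm of `I - l P`
  set l : ℝ := ε / B with hl
  have hlpos : 0 < l := by positivity
  have hlB : l * B = ε := by rw [hl]; field_simp
  choose J hJ using fun x => hT.exists_resolvent hlpos x
  have hJne : ∀ x y, ‖J x - J y‖ ≤ ‖x - y‖ := by
    intro x y
    have h := hT.1 (hJ x) (hJ y)
    rw [← smul_sub, real_inner_smul_left] at h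
    have h1 := nonneg_of_mul_nonneg_right h (by positivity)
    have e : x - J x - (y - J y) = (x - y) - (J x - J y) := by abel
    rw [e, inner_sub_left, real_inner_self_eq_norm_sq] at h1
    have h2 := real_inner_le_norm (x - y) (J x - J y)
    by_contra hlt
    push Not at hlt
    nlinarith [norm_nonneg (x - y), norm_nonneg (J x - J y)]
  -- square of the contraction factor of `I - l P`
  set κ : ℝ := 1 - l * ε with hκ
  have hle : l * ε ≤ 1 := by
    rw [hl, div_mul_eq_mul_div, div_le_one hBpos, hB]
    nlinarith [sq_nonneg ‖P‖]
  have hκ0 : 0 ≤ κ := by linarith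
  have hκ1 : κ < 1 := by nlinarith [mul_pos hlpos hε]
  have hcontr : ∀ x, ‖x - l • P x‖ ≤ Real.sqrt κ * ‖x‖ := by
    intro x
    refine abs_le_of_sq_le_sq' ?_ (by positivity) |>.2
    rw [mul_pow, Real.sq_sqrt hκ0, norm_sub_sq_real, real_inner_smul_right, norm_smul, mul_pow,
      Real.norm_eq_abs, sq_abs, real_inner_comm]
    have h1 := hPpos x
    have h2 : ‖P x‖ ^ 2 ≤ ‖P‖ ^ 2 * ‖x‖ ^ 2 := by
      rw [← mul_pow]
      exact pow_le_pow_left₀ (norm_nonneg _) (P.le_opNorm x) 2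
    have h3 : l ^ 2 * ‖P x‖ ^ 2 ≤ l * ε * ‖x‖ ^ 2 := by
      have : l ^ 2 * ‖P x‖ ^ 2 ≤ l ^ 2 * (B * ‖x‖ ^ 2) := by
        refine mul_le_mul_of_nonneg_left (h2.trans ?_) (sq_nonneg _)
        exact mul_le_mul_of_nonneg_right (by rw [hB]; nlinarith [sq_nonneg ε]) (sq_nonneg _)
      calc _ ≤ _ := this
        _ = l * (l * B) * ‖x‖ ^ 2 := by ring
        _ = _ := by rw [hlB]
    have h4 := mul_le_mul_of_nonneg_left h1 hlpos.le
    rw [hκ]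
    nlinarith
  have hK : ContractingWith (Real.toNNReal (Real.sqrt κ))
      (fun z => J (z - l • P z + l • v)) := by
    constructor
    · rw [Real.toNNReal_lt_one, Real.sqrt_lt' one_pos, one_pow]
      exact hκ1
    · refine LipschitzWith.of_dist_le_mul fun x y => ?_
      rw [dist_eq_norm, dist_eq_norm, Real.coe_toNNReal _ (Real.sqrt_nonneg _)]
      refine (hJne _ _).trans ?_
      have e : x - l • P x + l • v - (y - l • P y + l • v) = (x - y) - l • P (x - y) := by
        rw [map_sub, smul_sub]; abel
      rw [e]
      exact hcontr _
  have hfix := hK.fixedPoint_isFixedPt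
  set z := ContractingWith.fixedPoint (fun z => J (z - l • P z + l • v)) hK
  have hz : J (z - l • P z + l • v) = z := hfix
  have h := hJ (z - l • P z + l • v)
  rw [hz] at h
  refine ⟨z, ?_⟩
  have e : z - l • P z + l • v - z = l • (v - ε • z - M z) := by
    rw [hPz, smul_sub, smul_sub, smul_add]; abel
  rwa [e, inv_smul_smul₀ hlpos.ne'] at h

end Monotone

/-! ### Cocoercive operators and the momentum form of the iteration -/

section Cocoercive

variable {U : Type*} [NormedAddCommGroup U] [InnerProductSpace ℝ U]

/-- `Q` is `½`-cocoercive; equivalently, `id - Q` is nonexpansive. -/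
def IsHalfCocoercive (Q : U → U) : Prop :=
  ∀ x y, ‖Q x - Q y‖ ^ 2 / 2 ≤ inner ℝ (Q x - Q y) (x - y)

lemma IsHalfCocoercive.zero_right {Q : U → U} (hQ : IsHalfCocoercive Q) {p : U} (hp : Q p = 0)
    (x : U) : ‖Q x‖ ^ 2 / 2 ≤ inner ℝ (x - p) (Q x) := by
  have h := hQ x p
  rwa [hp, sub_zero, real_inner_comm] at h

/-- The zero set of `Q` is an intersection of half-spaces. -/
lemma IsHalfCocoercive.zeros_eq {Q : U → U} (hQ : IsHalfCocoercive Q) :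
    {p | Q p = 0} = ⋂ x, {p | inner ℝ (Q x) p ≤ inner ℝ (Q x) x - ‖Q x‖ ^ 2 / 2} := by
  ext p
  simp only [Set.mem_ofPred_eq, Set.mem_iInter]
  constructor
  · intro hp x
    have h := hQ.zero_right hp x
    rw [real_inner_comm, inner_sub_right] at h
    linarith
  · intro h
    have h1 := h p
    have h2 : ‖Q p‖ ^ 2 = 0 := le_antisymm (by linarith) (sq_nonneg _)
    simpa using h2

lemma IsHalfCocoercive.isClosed_zeros {Q : U → U} (hQ : IsHalfCocoercive Q) :
    IsClosed {p | Q p = 0} := by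
  rw [hQ.zeros_eq]
  exact isClosed_iInter fun x => isClosed_le (by fun_prop) continuous_const

lemma IsHalfCocoercive.convex_zeros {Q : U → U} (hQ : IsHalfCocoercive Q) :
    Convex ℝ {p | Q p = 0} := by
  rw [hQ.zeros_eq]
  exact convex_iInter fun x => convex_halfSpace_le (innerₛₗ ℝ (Q x)).isLinear _

lemma IsHalfCocoercive.norm_sub_sub_le {Q : U → U} (hQ : IsHalfCocoercive Q) (x y : U) :
    ‖(x - Q x) - (y - Q y)‖ ≤ ‖x - y‖ := by
  refine le_of_sq_le_sq ?_ (norm_nonneg _)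
  have e : (x - Q x) - (y - Q y) = (x - y) - (Q x - Q y) := by abel
  rw [e, norm_sub_sq_real, real_inner_comm]
  linarith [hQ x y]

/-- Demiclosedness of `Q` at `0`. -/
lemma IsHalfCocoercive.eq_zero_of_weakLim {Q : U → U} (hQ : IsHalfCocoercive Q) {ι : Type*}
    {F : Filter ι} [F.NeBot] {x : ι → U} {q : U} {R : ℝ} (hR : ∀ i, ‖x i‖ ≤ R)
    (hx : WeakLim F x q) (h0 : Tendsto (fun i => Q (x i)) F (𝓝 0)) : Q q = 0 := by
  have h1 : Tendsto (fun i => inner ℝ (x i) (Q (x i) - Q q) - inner ℝ q (Q (x i) - Q q)) F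
      (𝓝 (inner ℝ q (0 - Q q) - inner ℝ q (0 - Q q))) :=
    (hx.inner_strong hR (h0.sub_const _)).sub (tendsto_const_nhds.inner (h0.sub_const _))
  have h2 : Tendsto (fun i => ‖Q (x i) - Q q‖ ^ 2 / 2) F (𝓝 (‖0 - Q q‖ ^ 2 / 2)) :=
    ((h0.sub_const _).norm.pow 2).div_const 2
  have h3 := le_of_tendsto_of_tendsto' h2 h1 fun i => by
    have := hQ (x i) q
    rwa [real_inner_comm, inner_sub_left] at this
  rw [sub_self, zero_sub, norm_neg] at h3
  have h4 : ‖Q q‖ ^ 2 = 0 := le_antisymm (by linarith) (sq_nonneg _)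
  simpa using h4

/-- The accelerated iteration for a zero of `Q`, written with the momentum
`y k = k (x k - x̂ k)`, where `x̂ (k + 1) = x k - Q (x k)`. -/
structure IsMomentumIter (Q : U → U) (α : ℝ) (x y : ℕ → U) : Prop where
  zero : y 0 = 0
  momentum : ∀ k : ℕ, y (k + 1) =
    (((k : ℝ) + 1) / ((k : ℝ) + α)) • (y k + (α / 2) • Q (x k))
  step : ∀ k : ℕ, x (k + 1) = x k + ((k : ℝ) + 1)⁻¹ • y (k + 1) - Q (x k)

variable {Q : U → U} {α : ℝ} {x y : ℕ → U}

/-- Cocoercivity at two consecutive iterates. -/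
lemma IsMomentumIter.residual_le (h : IsMomentumIter Q α x y) (hQ : IsHalfCocoercive Q) (k : ℕ) :
    ((k : ℝ) + 1) * (‖Q (x (k + 1))‖ ^ 2 - ‖Q (x k)‖ ^ 2) ≤
      2 * (inner ℝ (y (k + 1)) (Q (x (k + 1))) - inner ℝ (y (k + 1)) (Q (x k))) := by
  have h1 := hQ (x (k + 1)) (x k)
  have hn : (0 : ℝ) < (k : ℝ) + 1 := by positivity
  have e : x (k + 1) - x k = ((k : ℝ) + 1)⁻¹ • y (k + 1) - Q (x k) := by
    rw [h.step k]; abel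
  rw [e, norm_sub_sq_real, inner_sub_left, inner_sub_right, inner_sub_right,
    real_inner_smul_right, real_inner_smul_right, real_inner_self_eq_norm_sq,
    real_inner_comm (y (k + 1)) (Q (x (k + 1))), real_inner_comm (y (k + 1)) (Q (x k))] at h1
  have h2 : (‖Q (x (k + 1))‖ ^ 2 - ‖Q (x k)‖ ^ 2) / 2 ≤ ((k : ℝ) + 1)⁻¹ *
      (inner ℝ (y (k + 1)) (Q (x (k + 1))) - inner ℝ (y (k + 1)) (Q (x k))) := by
    linarith
  rw [inv_mul_eq_div, le_div_iff₀ hn] at h2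
  linarith

end Cocoercive

/-! ### Strong convergence for parameter two: the Halpern iteration -/

section Halpern

lemma norm_le_of_norm_sub_le {V : Type*} [NormedAddCommGroup V] {a p : V} {R : ℝ}
    (h : ‖a - p‖ ≤ R) : ‖a‖ ≤ R + ‖p‖ := by
  have := norm_add_le (a - p) p
  rw [sub_add_cancel] at this
  linarith

variable {U : Type*} [NormedAddCommGroup U] [InnerProductSpace ℝ U]
variable {Q : U → U} {x y : ℕ → U}

/-- For `α = 2` the momentum is anchored at the starting point. -/
lemma IsMomentumIter.momentum_eq (h : IsMomentumIter Q 2 x y) (k : ℕ) : y k = x 0 - x k := by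
  induction k with
  | zero => rw [h.zero, sub_self]
  | succ k ih =>
    have hn : (0 : ℝ) < (k : ℝ) + 1 := by positivity
    have hn2 : (0 : ℝ) < (k : ℝ) + 2 := by positivity
    have h1 := h.momentum k
    rw [div_self two_ne_zero, one_smul] at h1
    have h2 : y (k + 1) + ((k : ℝ) + 1)⁻¹ • y (k + 1) = y k + Q (x k) := by
      rw [h1, smul_smul, ← add_smul]
      have : ((k : ℝ) + 1) / ((k : ℝ) + 2) +
          ((k : ℝ) + 1)⁻¹ * (((k : ℝ) + 1) / ((k : ℝ) + 2)) = 1 := by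
        field_simp
        ring
      rw [this, one_smul]
    have h3 : y (k + 1) = x 0 - x k + Q (x k) - ((k : ℝ) + 1)⁻¹ • y (k + 1) := by
      rw [← ih, ← h2]; abel
    rw [h3, h.step k]
    abel

/-- For `α = 2` the iteration is Halpern's: `x (k + 1)` averages `x 0` and `x k - Q (x k)`. -/
lemma IsMomentumIter.halpern (h : IsMomentumIter Q 2 x y) (k : ℕ) :
    x (k + 1) = ((k : ℝ) + 2)⁻¹ • x 0 + (((k : ℝ) + 1) / ((k : ℝ) + 2)) • (x k - Q (x k)) := by
  have hn2 : (0 : ℝ) < (k : ℝ) + 2 := by positivity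
  have h1 := h.momentum k
  rw [div_self two_ne_zero, one_smul, h.momentum_eq, h.momentum_eq] at h1
  have h2 : x (k + 1) = x 0 - (((k : ℝ) + 1) / ((k : ℝ) + 2)) • (x 0 - x k + Q (x k)) := by
    rw [← h1]; abel
  have h3 : ((k : ℝ) + 2)⁻¹ = 1 - ((k : ℝ) + 1) / ((k : ℝ) + 2) := by
    field_simp; ring
  rw [h2, h3]
  module

/-- Lieder's potential: for `α = 2` the residual decays like `1 / k`. -/
lemma IsMomentumIter.lieder (h : IsMomentumIter Q 2 x y) (hQ : IsHalfCocoercive Q) (k : ℕ) :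
    (k : ℝ) * ‖Q (x k)‖ ^ 2 ≤ 2 * inner ℝ (y k) (Q (x k)) := by
  induction k with
  | zero => simp [h.zero]
  | succ k ih =>
    have hr := h.residual_le hQ k
    have hn2 : (0 : ℝ) < (k : ℝ) + 2 := by positivity
    have hm := h.momentum k
    rw [div_self two_ne_zero, one_smul] at hm
    have h1 : inner ℝ (y (k + 1)) (Q (x k)) =
        ((k : ℝ) + 1) / ((k : ℝ) + 2) * (inner ℝ (y k) (Q (x k)) + ‖Q (x k)‖ ^ 2) := by
      rw [hm, real_inner_smul_left, inner_add_left, real_inner_self_eq_norm_sq]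
    have h2 : ((k : ℝ) + 1) * ‖Q (x k)‖ ^ 2 ≤ 2 * inner ℝ (y (k + 1)) (Q (x k)) := by
      rw [h1, div_mul_eq_mul_div, ← mul_div_assoc, le_div_iff₀ hn2]
      nlinarith
    push_cast
    linarith

lemma IsMomentumIter.norm_sub_le (h : IsMomentumIter Q 2 x y) (hQ : IsHalfCocoercive Q) {p : U}
    (hp : Q p = 0) (k : ℕ) : ‖x k - p‖ ≤ ‖x 0 - p‖ := by
  induction k with
  | zero => exact le_rfl
  | succ k ih =>
    have hn2 : (0 : ℝ) < (k : ℝ) + 2 := by positivity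
    have e : x (k + 1) - p = ((k : ℝ) + 2)⁻¹ • (x 0 - p) +
        (((k : ℝ) + 1) / ((k : ℝ) + 2)) • (x k - Q (x k) - p) := by
      have h3 : ((k : ℝ) + 2)⁻¹ = 1 - ((k : ℝ) + 1) / ((k : ℝ) + 2) := by
        field_simp; ring
      rw [h.halpern k, h3]
      module
    have h2 := hQ.norm_sub_sub_le (x k) p
    rw [hp, sub_zero] at h2
    rw [e]
    refine (norm_add_le _ _).trans ?_
    rw [norm_smul, norm_smul, Real.norm_of_nonneg (by positivity),
      Real.norm_of_nonneg (by positivity)]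
    calc _ ≤ ((k : ℝ) + 2)⁻¹ * ‖x 0 - p‖ + ((k : ℝ) + 1) / ((k : ℝ) + 2) * ‖x 0 - p‖ := by
          gcongr
          exact h2.trans ih
      _ = ‖x 0 - p‖ := by field_simp; ring

lemma IsMomentumIter.tendsto_residual (h : IsMomentumIter Q 2 x y) (hQ : IsHalfCocoercive Q)
    {p : U} (hp : Q p = 0) : Tendsto (fun k => Q (x k)) atTop (𝓝 0) := by
  have hb : ∀ k : ℕ, 0 < k → ‖Q (x k)‖ ≤ 4 * ‖x 0 - p‖ / k := by
    intro k hk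
    have hk' : (0 : ℝ) < k := by exact_mod_cast hk
    have h1 := h.lieder hQ k
    have h2 := real_inner_le_norm (y k) (Q (x k))
    have h3 : ‖y k‖ ≤ 2 * ‖x 0 - p‖ := by
      rw [h.momentum_eq, ← sub_sub_sub_cancel_right _ _ p]
      linarith [_root_.norm_sub_le (x 0 - p) (x k - p), h.norm_sub_le hQ hp k]
    rw [le_div_iff₀ hk']
    rcases (norm_nonneg (Q (x k))).eq_or_lt with h0 | h0
    · rw [← h0, zero_mul]; positivity
    · refine le_of_mul_le_mul_right ?_ h0
      nlinarith
  refine squeeze_zero_norm' ?_ (tendsto_const_div_atTop_nhds_zero_nat (4 * ‖x 0 - p‖))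
  filter_upwards [eventually_gt_atTop 0] with k hk using hb k hk

/-- An averaging recursion with asymptotically nonpositive perturbation forces convergence to
zero. -/
lemma tendsto_zero_of_averaging {s β : ℕ → ℝ} (hs : ∀ k, 0 ≤ s k)
    (hrec : ∀ k : ℕ, ((k : ℝ) + 2) * s (k + 1) ≤ ((k : ℝ) + 1) * s k + β k)
    (hβ : ∀ ε > 0, ∀ᶠ k in atTop, β k ≤ ε) : Tendsto s atTop (𝓝 0) := by
  refine tendsto_order.2 ⟨fun a ha => Eventually.of_forall fun k => ha.trans_le (hs k),
    fun ε hε => ?_⟩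
  obtain ⟨N, hN⟩ := (hβ (ε / 2) (by positivity)).exists_forall_of_atTop
  have hind : ∀ j : ℕ, (((N + j : ℕ) : ℝ) + 1) * s (N + j) ≤ ((N : ℝ) + 1) * s N + j * (ε / 2) := by
    intro j
    induction j with
    | zero => simp
    | succ j ih =>
      have h1 := hrec (N + j)
      have h2 := hN (N + j) (by omega)
      rw [← add_assoc]
      push_cast at h1 ih ⊢
      linarith
  obtain ⟨K, hK⟩ := exists_nat_gt (((N : ℝ) + 1) * s N / (ε / 2))
  filter_upwards [eventually_ge_atTop (N + K)] with k hk
  obtain ⟨j, rfl⟩ := Nat.exists_eq_add_of_le (show N ≤ k by omega)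
  have h1 := hind j
  have h2 : (K : ℝ) ≤ j := by exact_mod_cast (show K ≤ j by omega)
  rw [div_lt_iff₀ (by positivity)] at hK
  have h3 : (0 : ℝ) < ((N + j : ℕ) : ℝ) + 1 := by positivity
  by_contra hlt
  push Not at hlt
  push_cast at h1 h3
  nlinarith [mul_le_mul_of_nonneg_right h2 hε.le, mul_le_mul_of_nonneg_left hlt h3.le,
    (Nat.cast_nonneg N : (0 : ℝ) ≤ N)]

/-- Halpern's iteration converges strongly to the zero of `Q` nearest to the starting point; the
nearest point enters through its variational characterisation. -/
theorem IsMomentumIter.tendsto_halpern [CompleteSpace U] (h : IsMomentumIter Q 2 x y)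
    (hQ : IsHalfCocoercive Q) {p : U} (hp : Q p = 0)
    (hproj : ∀ q, Q q = 0 → inner ℝ (x 0 - p) (q - p) ≤ 0) : Tendsto x atTop (𝓝 p) := by
  have hbd : ∀ k, ‖x k‖ ≤ ‖x 0 - p‖ + ‖p‖ := fun k =>
    norm_le_of_norm_sub_le (h.norm_sub_le hQ hp k)
  have hlimsup : ∀ ε > 0, ∀ᶠ k in atTop, inner ℝ (x 0 - p) (x k - p) ≤ ε := by
    intro ε hε
    by_contra hcon
    rw [not_eventually] at hcon
    -- an ultrafilter concentrated on the violating indices gives a weak cluster point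
    have hne : (atTop ⊓ 𝓟 {k | ¬ inner ℝ (x 0 - p) (x k - p) ≤ ε}).NeBot :=
      frequently_mem_iff_neBot.1 hcon
    set G := Ultrafilter.of (atTop ⊓ 𝓟 {k | ¬ inner ℝ (x 0 - p) (x k - p) ≤ ε})
    have hG : (G : Filter ℕ) ≤ atTop ⊓ 𝓟 {k | ¬ inner ℝ (x 0 - p) (x k - p) ≤ ε} :=
      Ultrafilter.of_le _
    obtain ⟨q, hq⟩ := exists_weakLim_of_bounded G hbd
    have hq0 : Q q = 0 := hQ.eq_zero_of_weakLim hbd hq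
      ((h.tendsto_residual hQ hp).mono_left (hG.trans inf_le_left))
    have h1 : Tendsto (fun k => inner ℝ (x 0 - p) (x k - p)) G
        (𝓝 (inner ℝ (x 0 - p) (q - p))) := by
      simp only [inner_sub_right]
      refine Tendsto.sub_const ?_ _
      simpa only [real_inner_comm] using hq (x 0 - p)
    have h2 : ε ≤ inner ℝ (x 0 - p) (q - p) := by
      refine ge_of_tendsto h1 ?_
      have : {k | ¬ inner ℝ (x 0 - p) (x k - p) ≤ ε} ∈ (G : Filter ℕ) :=
        hG (mem_inf_of_right (mem_principal_self _))
      filter_upwards [this] with k hk using (not_le.1 hk).le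
    linarith [hproj q hq0]
  have hs : Tendsto (fun k => ‖x k - p‖ ^ 2) atTop (𝓝 0) := by
    refine tendsto_zero_of_averaging (β := fun k => 2 * inner ℝ (x 0 - p) (x (k + 1) - p))
      (fun k => sq_nonneg _) (fun k => ?_) (fun ε hε => ?_)
    · have hn2 : (0 : ℝ) < (k : ℝ) + 2 := by positivity
      have e : ((k : ℝ) + 2) • (x (k + 1) - p) - (x 0 - p) =
          ((k : ℝ) + 1) • (x k - Q (x k) - p) := by
        rw [h.halpern k, smul_sub, smul_add, smul_smul, smul_smul, mul_inv_cancel₀ hn2.ne',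
          mul_div_cancel₀ _ hn2.ne']
        module
      have h2 := hQ.norm_sub_sub_le (x k) p
      rw [hp, sub_zero] at h2
      have h3 := congrArg (fun v => ‖v‖ ^ 2) e
      rw [norm_sub_sq_real, norm_smul, norm_smul, mul_pow, mul_pow, Real.norm_eq_abs,
        Real.norm_eq_abs, sq_abs, sq_abs, real_inner_smul_left,
        real_inner_comm] at h3
      have h4 : ‖x k - Q (x k) - p‖ ^ 2 ≤ ‖x k - p‖ ^ 2 := pow_le_pow_left₀ (norm_nonneg _) h2 2
      have hk : (0 : ℝ) ≤ k := Nat.cast_nonneg k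
      have h5 : ((k : ℝ) + 2) * (((k : ℝ) + 2) * ‖x (k + 1) - p‖ ^ 2) ≤
          ((k : ℝ) + 2) * (((k : ℝ) + 1) * ‖x k - p‖ ^ 2 +
            2 * inner ℝ (x 0 - p) (x (k + 1) - p)) := by
        have h6 := mul_le_mul_of_nonneg_left h4 (sq_nonneg ((k : ℝ) + 1))
        have h7 : 0 ≤ ((k : ℝ) + 1) * ‖x k - p‖ ^ 2 := by positivity
        nlinarith [sq_nonneg ‖x 0 - p‖]
      exact le_of_mul_le_mul_left h5 hn2
    · have := (tendsto_add_atTop_nat 1).eventually (hlimsup (ε / 2) (by positivity))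
      filter_upwards [this] with k hk
      linarith
  rw [tendsto_iff_norm_sub_tendsto_zero]
  have := hs.sqrt
  simpa [Real.sqrt_sq (norm_nonneg _)] using this

end Halpern

/-! ### Weak convergence for parameters above two: a Lyapunov function -/

section Fast

variable {U : Type*} [NormedAddCommGroup U] [InnerProductSpace ℝ U]
variable {Q : U → U} {α : ℝ} {x y : ℕ → U} {p : U}

/-- The part of the Lyapunov function that does not involve a reference zero of `Q`; it is a
positive definite quadratic form in `y k` and `k Q (x k)`. -/
noncomputable def momentumEnergy (Q : U → U) (x y : ℕ → U) (k : ℕ) : ℝ :=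
  ‖y k‖ ^ 2 / 2 - k / 2 * inner ℝ (y k) (Q (x k)) + (k : ℝ) ^ 2 / 4 * ‖Q (x k)‖ ^ 2

/-- The part of the Lyapunov function that carries the parameter `lam` and compares with the
zero `p` of `Q`. -/
noncomputable def anchorEnergy (α : ℝ) (x y : ℕ → U) (p : U) (k : ℕ) : ℝ :=
  inner ℝ (x k - p) (y k) + (α - 1) / 2 * ‖x k - p‖ ^ 2

/-- The Lyapunov function of the accelerated iteration; it is affine in the parameter `lam`. -/
noncomputable def energy (Q : U → U) (α lam : ℝ) (x y : ℕ → U) (p : U) (k : ℕ) : ℝ :=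
  lam * anchorEnergy α x y p k + momentumEnergy Q x y k

/-- The dissipation in the step from `k` to `k + 1`. -/
noncomputable def dissipation (Q : U → U) (x y : ℕ → U) (k : ℕ) : ℝ :=
  ‖y (k + 1)‖ ^ 2 / ((k : ℝ) + 1) + ((k : ℝ) + 1) * ‖Q (x k)‖ ^ 2

lemma dissipation_nonneg {V : Type*} [NormedAddCommGroup V] {Q : V → V} {x y : ℕ → V} (k : ℕ) :
    0 ≤ dissipation Q x y k := by
  unfold dissipation; positivity

lemma sq_norm_le_momentumEnergy (k : ℕ) : ‖y k‖ ^ 2 / 4 ≤ momentumEnergy Q x y k := by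
  have h := sq_nonneg ‖y k - (k : ℝ) • Q (x k)‖
  rw [norm_sub_sq_real, real_inner_smul_right, norm_smul, mul_pow, Real.norm_eq_abs, sq_abs] at h
  unfold momentumEnergy
  linarith

lemma momentumEnergy_le (k : ℕ) :
    momentumEnergy Q x y k ≤ ‖y k‖ ^ 2 + (k : ℝ) ^ 2 * ‖Q (x k)‖ ^ 2 := by
  have h := sq_nonneg ‖y k + (k : ℝ) • Q (x k)‖
  rw [norm_add_sq_real, real_inner_smul_right, norm_smul, mul_pow, Real.norm_eq_abs, sq_abs] at h
  unfold momentumEnergy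
  nlinarith [sq_nonneg ‖y k‖, mul_nonneg (sq_nonneg (k : ℝ)) (sq_nonneg ‖Q (x k)‖)]

/-- The energy is a sum of nonnegative terms: besides the one displayed,
`½‖lam (x k - p) + y k - (k / 2) Q (x k)‖²` and multiples of `⟪x k - p, Q (x k)⟫` and
`‖Q (x k)‖²`. -/
lemma le_energy (hQ : IsHalfCocoercive Q) (hp : Q p = 0) {lam : ℝ} (hlam : 0 ≤ lam) (k : ℕ) :
    lam * (α - 1 - lam) / 2 * ‖x k - p‖ ^ 2 ≤ energy Q α lam x y p k := by
  have h := sq_nonneg ‖lam • (x k - p) + y k - ((k : ℝ) / 2) • Q (x k)‖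
  have h1 := hQ.zero_right hp (x k)
  have h2 : 0 ≤ inner ℝ (x k - p) (Q (x k)) := le_trans (by positivity) h1
  rw [norm_sub_sq_real, norm_add_sq_real, inner_add_left, real_inner_smul_left,
    real_inner_smul_left, real_inner_smul_right, real_inner_smul_right, norm_smul, norm_smul,
    mul_pow, mul_pow, Real.norm_eq_abs, Real.norm_eq_abs, sq_abs, sq_abs] at h
  have h3 : 0 ≤ lam * k * inner ℝ (x k - p) (Q (x k)) := by positivity
  have h4 : 0 ≤ (k : ℝ) ^ 2 * ‖Q (x k)‖ ^ 2 := by positivity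
  unfold energy anchorEnergy momentumEnergy
  nlinarith

/-- The change of the energy in one step, with `n = k + 1`, `z = x k - p`, `Y = y (k + 1)`,
`e = Q (x k)` and `e' = Q (x (k + 1))`. The first term on the right is nonpositive by
`IsMomentumIter.residual_le`. -/
lemma energy_step_identity (z Y e e' : U) (lam : ℝ) {n α : ℝ} (hn : n ≠ 0) :
    (lam * (inner ℝ (z + n⁻¹ • Y - e) Y + (α - 1) / 2 * ‖z + n⁻¹ • Y - e‖ ^ 2) +
      (‖Y‖ ^ 2 / 2 - n / 2 * inner ℝ Y e' + n ^ 2 / 4 * ‖e'‖ ^ 2)) -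
    (lam * (inner ℝ z (((n - 1 + α) / n) • Y - (α / 2) • e) + (α - 1) / 2 * ‖z‖ ^ 2) +
      (‖((n - 1 + α) / n) • Y - (α / 2) • e‖ ^ 2 / 2 -
        (n - 1) / 2 * inner ℝ (((n - 1 + α) / n) • Y - (α / 2) • e) e +
        (n - 1) ^ 2 / 4 * ‖e‖ ^ 2)) =
    n / 4 * (n * (‖e'‖ ^ 2 - ‖e‖ ^ 2) - 2 * (inner ℝ Y e' - inner ℝ Y e))
      - lam * (α / 2 - 1) * inner ℝ z e
      - (α - 1 - lam) * (‖Y‖ ^ 2 / n)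
      + ((α - 1 - lam) - ((α / 2 - 1) * (α - 1) + (α / 2 - 1) + 1 / 2) / n) * inner ℝ Y e
      - (α - 1 - lam) * (α - 1) / 2 * ‖n⁻¹ • Y - e‖ ^ 2
      + ((α / 2 - 1) * (α - 1) - (α / 2 - 1) ^ 2 / 2 + 1 / 4 - (α / 2 - 1) / 2 * (n - 1))
        * ‖e‖ ^ 2 := by
  simp only [← real_inner_self_eq_norm_sq, inner_add_left, inner_sub_left, inner_add_right,
    inner_sub_right, real_inner_smul_left, real_inner_smul_right]
  rw [real_inner_comm z Y, real_inner_comm z e, real_inner_comm Y e]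
  field_simp
  ring

/-- The energy dissipates from some index on, for the parameters `lam = α - 1 - nu` with
`nu ∈ [β / 2, β]`, where `β = α / 2 - 1`. -/
lemma IsMomentumIter.eventually_energy_add_le (h : IsMomentumIter Q α x y)
    (hQ : IsHalfCocoercive Q) (hp : Q p = 0) (hα : 2 < α) {nu : ℝ} (hnu1 : (α / 2 - 1) / 2 ≤ nu)
    (hnu2 : nu ≤ α / 2 - 1) :
    ∀ᶠ k in atTop, energy Q α (α - 1 - nu) x y p (k + 1) +
      (α / 2 - 1) / 16 * dissipation Q x y k ≤ energy Q α (α - 1 - nu) x y p k := by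
  set β : ℝ := α / 2 - 1 with hβ
  have hβ0 : 0 < β := by rw [hβ]; linarith
  have hα' : α = 2 * β + 2 := by rw [hβ]; ring
  set K₁ : ℝ := β * (α - 1) + β + 1 / 2 with hK₁
  set K₂ : ℝ := β * (α - 1) + β / 2 + 1 / 4 with hK₂
  have hK₁0 : 0 < K₁ := by rw [hK₁, hα']; nlinarith
  have hK₂0 : 0 < K₂ := by rw [hK₂, hα']; nlinarith
  obtain ⟨N, hN⟩ := exists_nat_gt (16 * (K₁ + K₂) / β)
  filter_upwards [eventually_ge_atTop N] with k hk
  have hkN : (N : ℝ) ≤ k := by exact_mod_cast hk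
  set n : ℝ := (k : ℝ) + 1 with hn
  have hn0 : 0 < n := by positivity
  have hnK : 16 * (K₁ + K₂) ≤ β * n := by
    rw [div_lt_iff₀ hβ0] at hN
    nlinarith
  have hstep := h.step k
  have hmom := h.momentum k
  have hka : 0 < (k : ℝ) + α := by positivity
  have hy : y k = ((n - 1 + α) / n) • y (k + 1) - (α / 2) • Q (x k) := by
    rw [hmom, smul_smul]
    have : (n - 1 + α) / n * (n / ((k : ℝ) + α)) = 1 := by
      rw [hn]; field_simp; ring
    rw [this, one_smul]
    abel
  have hx : x (k + 1) - p = (x k - p) + n⁻¹ • y (k + 1) - Q (x k) := by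
    rw [hstep]; abel
  have hid := energy_step_identity (x k - p) (y (k + 1)) (Q (x k)) (Q (x (k + 1)))
    (α - 1 - nu) (α := α) hn0.ne'
  rw [← hy, ← hx] at hid
  have hE₁ : energy Q α (α - 1 - nu) x y p (k + 1) =
      (α - 1 - nu) * (inner ℝ (x (k + 1) - p) (y (k + 1)) + (α - 1) / 2 * ‖x (k + 1) - p‖ ^ 2) +
      (‖y (k + 1)‖ ^ 2 / 2 - n / 2 * inner ℝ (y (k + 1)) (Q (x (k + 1))) +
        n ^ 2 / 4 * ‖Q (x (k + 1))‖ ^ 2) := by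
    unfold energy anchorEnergy momentumEnergy
    push_cast
    rfl
  have hE₀ : energy Q α (α - 1 - nu) x y p k =
      (α - 1 - nu) * (inner ℝ (x k - p) (y k) + (α - 1) / 2 * ‖x k - p‖ ^ 2) +
      (‖y k‖ ^ 2 / 2 - (n - 1) / 2 * inner ℝ (y k) (Q (x k)) +
        (n - 1) ^ 2 / 4 * ‖Q (x k)‖ ^ 2) := by
    rw [hn, add_sub_cancel_right]
    rfl
  rw [← hE₁, ← hE₀, ← hβ] at hid
  have hr := h.residual_le hQ k
  have hz : 0 ≤ inner ℝ (x k - p) (Q (x k)) := le_trans (by positivity) (hQ.zero_right hp (x k))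
  set Y := y (k + 1)
  set e := Q (x k)
  -- the dissipation is `A + B`
  set A : ℝ := ‖Y‖ ^ 2 / n with hA
  set B : ℝ := n * ‖e‖ ^ 2 with hB
  have hA0 : 0 ≤ A := by positivity
  have hB0 : 0 ≤ B := by positivity
  have hYe : ∀ t : ℝ, 0 < t → 2 * |inner ℝ Y e| ≤ t * A + B / t := by
    intro t ht
    have h1 := abs_real_inner_le_norm Y e
    have h2 : 0 ≤ t / n * (‖Y‖ - n / t * ‖e‖) ^ 2 := by positivity
    have h3 : t / n * (‖Y‖ - n / t * ‖e‖) ^ 2 = t * A + B / t - 2 * (‖Y‖ * ‖e‖) := by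
      rw [hA, hB]; field_simp; ring
    linarith
  have h1 : n / 4 * (n * (‖Q (x (k + 1))‖ ^ 2 - ‖e‖ ^ 2) -
      2 * (inner ℝ Y (Q (x (k + 1))) - inner ℝ Y e)) ≤ 0 :=
    mul_nonpos_of_nonneg_of_nonpos (by positivity) (by linarith)
  have h2 : 0 ≤ (α - 1 - nu) * β * inner ℝ (x k - p) e :=
    mul_nonneg (mul_nonneg (by linarith) hβ0.le) hz
  have h3 : 0 ≤ nu * (α - 1) / 2 * ‖n⁻¹ • Y - e‖ ^ 2 :=
    mul_nonneg (div_nonneg (mul_nonneg (by linarith) (by linarith)) two_pos.le) (sq_nonneg _)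
  -- `t = 4 / 3` makes the leading quadratic form negative for all `nu ∈ [β / 2, β]`
  have h4 : nu * inner ℝ Y e ≤ nu * (2 / 3 * A + 3 / 8 * B) := by
    refine mul_le_mul_of_nonneg_left ?_ (by linarith)
    have := hYe (4 / 3) (by norm_num)
    have := le_abs_self (inner ℝ Y e)
    linarith
  have h5 : -(K₁ / n * inner ℝ Y e) ≤ K₁ / n * ((A + B) / 2) := by
    rw [← mul_neg]
    refine mul_le_mul_of_nonneg_left ?_ (by positivity)
    have := hYe 1 one_pos
    have := neg_abs_le (inner ℝ Y e)
    linarith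
  have h6 : K₁ / n + K₂ / n ≤ β / 16 := by
    rw [← add_div, div_le_iff₀ hn0]; linarith
  have h7 : K₂ * ‖e‖ ^ 2 = K₂ / n * B := by rw [hB]; field_simp
  have h8 : n * ‖e‖ ^ 2 = B := rfl
  have h9 : dissipation Q x y k = A + B := rfl
  have h10 : 0 ≤ K₁ / n := by positivity
  have h12 : (β * (α - 1) - β ^ 2 / 2 + 1 / 4 - β / 2 * (n - 1)) * ‖e‖ ^ 2 ≤
      K₂ / n * B - β / 2 * B := by
    have : (β * (α - 1) - β ^ 2 / 2 + 1 / 4 - β / 2 * (n - 1)) * ‖e‖ ^ 2 =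
        K₂ * ‖e‖ ^ 2 - β / 2 * (n * ‖e‖ ^ 2) - β ^ 2 / 2 * ‖e‖ ^ 2 := by
      rw [hK₂]; ring
    rw [this, h7, h8]
    have : 0 ≤ β ^ 2 / 2 * ‖e‖ ^ 2 := by positivity
    linarith
  have h13 : K₁ / n * (A + B) ≤ (β / 16 - K₂ / n) * (A + B) :=
    mul_le_mul_of_nonneg_right (by linarith) (by positivity)
  have h14 : 0 ≤ K₂ / n * A := by positivity
  have h15 : 0 ≤ (nu - β / 2) * A := mul_nonneg (by linarith) hA0
  have h16 : 0 ≤ (β - nu) * B := mul_nonneg (by linarith) hB0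
  have h17 : 0 ≤ β * A := by positivity
  have e1 : α - 1 - (α - 1 - nu) = nu := by ring
  rw [e1, ← hK₁] at hid
  rw [h9]
  have h19 : (nu - K₁ / n) * inner ℝ Y e = nu * inner ℝ Y e - K₁ / n * inner ℝ Y e := by ring
  have h20 : 0 ≤ K₁ / n * (A + B) := by positivity
  linarith

/-- A sequence that is bounded below and from some index on decreases by at least `d k ≥ 0`
converges, and `d` is summable. -/
lemma tendsto_and_summable_of_descent {E d : ℕ → ℝ} (hE : ∀ k, 0 ≤ E k) (hd : ∀ k, 0 ≤ d k)
    (h : ∀ᶠ k in atTop, E (k + 1) + d k ≤ E k) :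
    (∃ l, Tendsto E atTop (𝓝 l)) ∧ Summable d := by
  obtain ⟨N, hN⟩ := h.exists_forall_of_atTop
  constructor
  · have hanti : Antitone fun k => E (k + N) := antitone_nat_of_succ_le fun k => by
      have h1 := hN (k + N) (by omega)
      have h2 := hd (k + N)
      rw [show k + 1 + N = k + N + 1 by omega]
      linarith
    refine ⟨_, (tendsto_add_atTop_iff_nat N).1 (tendsto_atTop_ciInf hanti ⟨0, ?_⟩)⟩
    rintro _ ⟨k, rfl⟩
    exact hE _
  · rw [← summable_nat_add_iff N]
    refine summable_of_sum_range_le (c := E N) (fun k => hd _) fun m => ?_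
    have : ∑ i ∈ Finset.range m, d (i + N) ≤ E N - E (m + N) := by
      induction m with
      | zero => simp
      | succ m ih =>
        rw [Finset.sum_range_succ, show m + 1 + N = m + N + 1 by omega]
        linarith [hN (m + N) (by omega)]
    linarith [hE (m + N)]

/-- A convergent nonnegative sequence `u` with `∑ u k / k < ∞` tends to zero. -/
lemma eq_zero_of_tendsto_of_summable_div {u : ℕ → ℝ} {l : ℝ} (hu : ∀ k, 0 ≤ u k)
    (hl : Tendsto u atTop (𝓝 l)) (hs : Summable fun k => u k / ((k : ℝ) + 1)) : l = 0 := by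
  by_contra hne
  have hpos : 0 < l := lt_of_le_of_ne (ge_of_tendsto' hl hu) (Ne.symm hne)
  refine Real.not_summable_one_div_natCast ((summable_nat_add_iff 1).1 ?_)
  refine Summable.of_norm_bounded_eventually_nat (hs.mul_left (2 / l)) ?_
  filter_upwards [hl.eventually (lt_mem_nhds (half_lt_self hpos))] with k hk
  have hk1 : (0 : ℝ) < (k : ℝ) + 1 := by positivity
  push_cast
  rw [Real.norm_of_nonneg (by positivity), ← mul_div_assoc]
  refine div_le_div_of_nonneg_right ?_ hk1.le
  rw [div_mul_eq_mul_div, le_div_iff₀ hpos]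
  linarith

lemma exists_bound_of_tendsto {u : ℕ → ℝ} {l : ℝ} (h : Tendsto u atTop (𝓝 l)) :
    ∃ R, ∀ k, u k ≤ R := by
  obtain ⟨R, hR⟩ := h.bddAbove_range
  exact ⟨R, fun k => hR ⟨k, rfl⟩⟩

/-- Residuals vanish and distances to every zero converge. -/
lemma IsMomentumIter.asymptotics (h : IsMomentumIter Q α x y)
    (hQ : IsHalfCocoercive Q) (hp : Q p = 0) (hα : 2 < α) :
    (∃ R, ∀ k, ‖x k‖ ≤ R) ∧ Tendsto (fun k => Q (x k)) atTop (𝓝 0) ∧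
      ∃ l, Tendsto (fun k => ‖x k - p‖ ^ 2) atTop (𝓝 l) := by
  set β : ℝ := α / 2 - 1 with hβ
  have hβ0 : 0 < β := by rw [hβ]; linarith
  have hnonneg : ∀ nu, 0 ≤ nu → nu ≤ β → ∀ k, 0 ≤ energy Q α (α - 1 - nu) x y p k := by
    intro nu h0 h1 k
    refine le_trans ?_ (le_energy hQ hp (by linarith) k)
    have : 0 ≤ α - 1 - nu := by linarith
    have : 0 ≤ α - 1 - (α - 1 - nu) := by linarith
    positivity
  have hdesc : ∀ nu, β / 2 ≤ nu → nu ≤ β →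
      (∃ l, Tendsto (energy Q α (α - 1 - nu) x y p) atTop (𝓝 l)) ∧
        Summable fun k => β / 16 * dissipation Q x y k := fun nu h0 h1 =>
    tendsto_and_summable_of_descent (hnonneg nu (by linarith) h1)
      (fun k => mul_nonneg (by positivity) (dissipation_nonneg k))
      (h.eventually_energy_add_le hQ hp hα h0 h1)
  obtain ⟨⟨l₁, h₁⟩, hsum⟩ := hdesc β (by linarith) le_rfl
  obtain ⟨⟨l₂, h₂⟩, -⟩ := hdesc (β / 2) le_rfl (by linarith)
  have hsum' : Summable (dissipation Q x y) := (summable_mul_left_iff (by positivity)).1 hsum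
  -- two values of the parameter separate the two parts of the energy
  have hanchor : Tendsto (anchorEnergy α x y p) atTop (𝓝 ((l₂ - l₁) / (β / 2))) := by
    refine ((h₂.sub h₁).div_const (β / 2)).congr fun k => ?_
    unfold energy
    field_simp
    ring
  have hmomentum : Tendsto (momentumEnergy Q x y) atTop
      (𝓝 (l₁ - (α - 1 - β) * ((l₂ - l₁) / (β / 2)))) := by
    refine (h₁.sub (hanchor.const_mul (α - 1 - β))).congr fun k => ?_
    unfold energy
    ring
  have hm0 : ∀ k, 0 ≤ momentumEnergy Q x y k := fun k =>
    le_trans (by positivity) (sq_norm_le_momentumEnergy k)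
  have hlim0 : l₁ - (α - 1 - β) * ((l₂ - l₁) / (β / 2)) = 0 := by
    refine eq_zero_of_tendsto_of_summable_div (fun k => hm0 (k + 1))
      (hmomentum.comp (tendsto_add_atTop_nat 1)) ?_
    refine Summable.of_nonneg_of_le (fun k => div_nonneg (hm0 _) (by positivity)) (fun k => ?_)
      (hsum'.add ((summable_nat_add_iff 1).2 hsum'))
    have hk : (0 : ℝ) < (k : ℝ) + 1 := by positivity
    have h1 := momentumEnergy_le (Q := Q) (x := x) (y := y) (k + 1)
    unfold dissipation
    push_cast at h1 ⊢
    have h2 : momentumEnergy Q x y (k + 1) / ((k : ℝ) + 1) ≤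
        ‖y (k + 1)‖ ^ 2 / ((k : ℝ) + 1) + ((k : ℝ) + 1) * ‖Q (x (k + 1))‖ ^ 2 := by
      rw [div_le_iff₀ hk, add_mul, div_mul_cancel₀ _ hk.ne']
      linarith
    have h3 : 0 ≤ ((k : ℝ) + 1) * ‖Q (x k)‖ ^ 2 := by positivity
    have h4 : 0 ≤ ‖y (k + 1 + 1)‖ ^ 2 / ((k : ℝ) + 1 + 1) := by positivity
    nlinarith [sq_nonneg ‖Q (x (k + 1))‖]
  rw [hlim0] at hmomentum
  have hy0 : Tendsto y atTop (𝓝 0) := by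
    have h1 : Tendsto (fun k => ‖y k‖ ^ 2) atTop (𝓝 0) := by
      refine squeeze_zero (fun k => sq_nonneg _) (fun k => ?_)
        (by simpa using hmomentum.const_mul 4)
      linarith [sq_norm_le_momentumEnergy (Q := Q) (x := x) (y := y) k]
    rw [tendsto_zero_iff_norm_tendsto_zero]
    simpa [Real.sqrt_sq (norm_nonneg _)] using h1.sqrt
  have hQ0 : Tendsto (fun k => Q (x k)) atTop (𝓝 0) := by
    have h1 : Tendsto (fun k => ‖Q (x k)‖ ^ 2) atTop (𝓝 0) := by
      refine squeeze_zero (fun k => sq_nonneg _) (fun k => ?_) hsum'.tendsto_atTop_zero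
      have hk : (0 : ℝ) ≤ k := Nat.cast_nonneg k
      have h4 : 0 ≤ ‖y (k + 1)‖ ^ 2 / ((k : ℝ) + 1) := by positivity
      unfold dissipation
      nlinarith [sq_nonneg ‖Q (x k)‖]
    rw [tendsto_zero_iff_norm_tendsto_zero]
    simpa [Real.sqrt_sq (norm_nonneg _)] using h1.sqrt
  obtain ⟨R, hR⟩ : ∃ R, ∀ k, ‖x k - p‖ ≤ R := by
    obtain ⟨R, hR⟩ := exists_bound_of_tendsto h₁
    have hc : 0 < (α - 1 - β) * (α - 1 - (α - 1 - β)) / 2 := by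
      have : 0 < α - 1 - β := by linarith
      have : 0 < α - 1 - (α - 1 - β) := by linarith
      positivity
    refine ⟨Real.sqrt (R / ((α - 1 - β) * (α - 1 - (α - 1 - β)) / 2)), fun k => ?_⟩
    refine Real.le_sqrt_of_sq_le ?_
    rw [le_div_iff₀ hc, mul_comm]
    exact (le_energy hQ hp (by linarith) k).trans (hR k)
  have hcross : Tendsto (fun k => inner ℝ (x k - p) (y k)) atTop (𝓝 0) := by
    refine squeeze_zero_norm (a := fun k => R * ‖y k‖) (fun k => ?_)
      (by simpa using hy0.norm.const_mul R)
    exact (norm_inner_le_norm _ _).trans (mul_le_mul_of_nonneg_right (hR k) (norm_nonneg _))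
  refine ⟨⟨R + ‖p‖, fun k => norm_le_of_norm_sub_le (hR k)⟩, hQ0, _,
    ((hanchor.sub hcross).div_const ((α - 1) / 2)).congr fun k => ?_⟩
  have : α - 1 ≠ 0 := by linarith
  unfold anchorEnergy
  field_simp
  ring

/-- For `α > 2` the accelerated iteration is bounded, its residual vanishes, and it converges
weakly to a zero of `Q`. -/
theorem IsMomentumIter.exists_weakLim [CompleteSpace U] (h : IsMomentumIter Q α x y)
    (hQ : IsHalfCocoercive Q) (hp : Q p = 0) (hα : 2 < α) :
    (∃ R, ∀ k, ‖x k‖ ≤ R) ∧ Tendsto (fun k => Q (x k)) atTop (𝓝 0) ∧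
      ∃ q, Q q = 0 ∧ WeakLim atTop x q := by
  obtain ⟨⟨R, hR⟩, hQ0, -⟩ := h.asymptotics hQ hp hα
  refine ⟨⟨R, hR⟩, hQ0, ?_⟩
  exact exists_weakLim_of_opial (S := {q | Q q = 0}) hR
    (fun s hs => (h.asymptotics hQ hs hα).2.2)
    (fun G q hG hq => hQ.eq_zero_of_weakLim hR hq (hQ0.mono_left hG))

end Fast

/-! ### Reduction to the range space of the adjoint -/

section Reduction

open ContinuousLinearMap (adjoint adjoint_inner_left adjoint_inner_right)

variable {H : Type*} [NormedAddCommGroup H] [InnerProductSpace ℝ H]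

lemma mem_inv_addOp {M : H →L[ℝ] H} {T : H → Set H} {v z : H} :
    z ∈ inv (addOp M T) v ↔ v - M z ∈ T z := by
  constructor
  · rintro ⟨t, ht, h⟩
    rwa [h, add_sub_cancel_left]
  · intro h
    exact ⟨_, h, by abel⟩

variable [CompleteSpace H]
variable {U : Type*} [NormedAddCommGroup U] [InnerProductSpace ℝ U] [CompleteSpace U]

/-- If `C` is injective and `C C*` has closed range, then `C*` is onto: `C u` is a limit of points
of the range of `C C*`, because the range of `C*` is dense. -/
lemma adjoint_surjective (C : U →L[ℝ] H) (hC : Function.Injective C)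
    (hr : IsClosed (Set.range (C ∘L adjoint C))) : Function.Surjective (adjoint C) := by
  have hdense : ((adjoint C).range).topologicalClosure = ⊤ := by
    rw [Submodule.topologicalClosure_eq_top_iff, ContinuousLinearMap.orthogonal_range,
      ContinuousLinearMap.adjoint_adjoint, LinearMap.ker_eq_bot]
    exact hC
  intro u
  have hu : u ∈ closure (Set.range (adjoint C)) := by
    have : u ∈ ((adjoint C).range).topologicalClosure := hdense ▸ Submodule.mem_top
    exact this
  have h1 : C u ∈ closure (Set.range (C ∘L adjoint C)) := by
    have h2 := image_closure_subset_closure_image C.continuous (Set.mem_image_of_mem C hu)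
    rwa [← Set.range_comp] at h2
  rw [hr.closure_eq] at h1
  obtain ⟨w, hw⟩ := h1
  exact ⟨w, hC hw⟩

/-- The relaxed residual of the reduced resolvent `C* g`, where `g = (M + T)⁻¹ C`. -/
noncomputable def residual (C : U →L[ℝ] H) (g : U → H) (ρ : ℝ) (u : U) : U :=
  ρ • (u - adjoint C (g u))

variable {T : H → Set H} {C : U →L[ℝ] H} {g : U → H} {ρ : ℝ}

/-- The reduced resolvent is firmly nonexpansive, so its relaxed residual is `½`-cocoercive. -/
lemma isHalfCocoercive_residual (hT : IsMonotoneOp T)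
    (hg : ∀ u, C (u - adjoint C (g u)) ∈ T (g u)) (hρ : 0 ≤ ρ) (hρ2 : ρ ≤ 2) :
    IsHalfCocoercive (residual C g ρ) := by
  intro u v
  have h := hT (hg u) (hg v)
  rw [← map_sub, ← adjoint_inner_right, map_sub] at h
  unfold residual
  set d := u - adjoint C (g u) - (v - adjoint C (g v)) with hd
  have e : u - v = d + (adjoint C (g u) - adjoint C (g v)) := by rw [hd]; abel
  rw [← smul_sub, ← hd, e, real_inner_smul_left, inner_add_right, real_inner_self_eq_norm_sq,
    norm_smul, mul_pow, Real.norm_eq_abs, sq_abs]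
  have h1 := mul_nonneg hρ h
  have h2 : 0 ≤ ρ * (2 - ρ) * ‖d‖ ^ 2 :=
    mul_nonneg (mul_nonneg hρ (by linarith)) (sq_nonneg _)
  nlinarith

lemma residual_eq_zero_iff (hρ : 0 < ρ) {u : U} :
    residual C g ρ u = 0 ↔ adjoint C (g u) = u := by
  unfold residual
  rw [smul_eq_zero_iff_right hρ.ne', sub_eq_zero, eq_comm]

lemma mem_zeros_of_residual_eq_zero (hg : ∀ u, C (u - adjoint C (g u)) ∈ T (g u)) (hρ : 0 < ρ)
    {u : U} (hu : residual C g ρ u = 0) : g u ∈ inv T 0 := by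
  have h := hg u
  rwa [(residual_eq_zero_iff hρ).1 hu, sub_self, map_zero] at h

/-- The zeros of the residual are the image under `C*` of the zeros of `T`. -/
lemma zeros_residual (hg : ∀ u, C (u - adjoint C (g u)) ∈ T (g u))
    (hu : ∀ u z, C (u - adjoint C z) ∈ T z → z = g u) (hρ : 0 < ρ) :
    {u | residual C g ρ u = 0} = adjoint C '' inv T 0 := by
  ext u
  constructor
  · intro h
    exact ⟨g u, mem_zeros_of_residual_eq_zero hg hρ h, (residual_eq_zero_iff hρ).1 h⟩
  · rintro ⟨z, hz, rfl⟩
    have h : z = g (adjoint C z) := hu _ _ (by rw [sub_self, map_zero]; exact hz)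
    exact (residual_eq_zero_iff hρ).2 (by rw [← h])

/-- The accelerated scheme in momentum form. -/
lemma isMomentumIter_of_accelerated {V : Type*} [NormedAddCommGroup V] [InnerProductSpace ℝ V]
    {Q : V → V} {α : ℝ} (hα : 0 < α) {x xhat : ℕ → V} (h1 : ∀ k, xhat (k + 1) = x k - Q (x k))
    (h2 : ∀ k : ℕ, x (k + 1) = x k + (α / (2 * ((k : ℝ) + α))) • (xhat (k + 1) - x k)
      + ((k : ℝ) / ((k : ℝ) + α)) • (xhat (k + 1) - xhat k)) :
    IsMomentumIter Q α x fun k => (k : ℝ) • (x k - xhat k) := by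
  refine ⟨by simp, fun k => ?_, fun k => ?_⟩
  · have hka : (k : ℝ) + α ≠ 0 := by positivity
    have e : x (k + 1) - xhat (k + 1) =
        ((k : ℝ) + α)⁻¹ • ((k : ℝ) • (x k - xhat k) + (α / 2) • Q (x k)) := by
      have ha : α / (2 * ((k : ℝ) + α)) = ((k : ℝ) + α)⁻¹ * (α / 2) := by field_simp
      have hb : (k : ℝ) / ((k : ℝ) + α) = ((k : ℝ) + α)⁻¹ * k := by field_simp
      have hone : Q (x k) = (((k : ℝ) + α)⁻¹ * ((k : ℝ) + α)) • Q (x k) := by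
        rw [inv_mul_cancel₀ hka, one_smul]
      have h3 : x (k + 1) - xhat (k + 1) = (((k : ℝ) + α)⁻¹ * ((k : ℝ) + α)) • Q (x k)
          + (((k : ℝ) + α)⁻¹ * (α / 2)) • (-Q (x k))
          + (((k : ℝ) + α)⁻¹ * k) • (x k - Q (x k) - xhat k) := by
        rw [← hone, h2 k, ha, hb, h1 k]
        have : x k - Q (x k) - x k = -Q (x k) := by abel
        rw [this]
        abel
      rw [h3]
      module
    push_cast
    rw [e, smul_smul, ← div_eq_mul_inv]
  · have hk : (k : ℝ) + 1 ≠ 0 := by positivity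
    push_cast
    rw [inv_smul_smul₀ hk, h1 k]
    abel

/-- A closed convex nonempty set in a Hilbert space has a nearest point, with its variational
characterisation. -/
lemma exists_isProjOnto {V : Type*} [NormedAddCommGroup V] [InnerProductSpace ℝ V]
    [CompleteSpace V] {K : Set V} (hne : K.Nonempty) (hcl : IsClosed K) (hcv : Convex ℝ K)
    (x : V) : ∃ p, IsProjOnto K x p ∧ ∀ q ∈ K, inner ℝ (x - p) (q - p) ≤ 0 := by
  obtain ⟨p, hpK, hp⟩ := exists_norm_eq_iInf_of_complete_convex hne hcl.isComplete hcv x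
  have hvar := (norm_eq_iInf_iff_real_inner_le_zero hcv hpK).1 hp
  refine ⟨p, ⟨hpK, fun q hq hne => ?_⟩, hvar⟩
  refine lt_of_pow_lt_pow_left₀ 2 (norm_nonneg _) ?_
  have e : x - q = (x - p) - (q - p) := by abel
  have hpos : 0 < ‖q - p‖ ^ 2 := by
    have : 0 < ‖q - p‖ := norm_pos_iff.2 (sub_ne_zero.2 hne)
    positivity
  rw [e, norm_sub_sq_real (x - p)]
  linarith [hvar q hq]

/-- Geometric recursions with vanishing perturbation converge to zero. -/
lemma tendsto_zero_of_contraction {s ε : ℕ → ℝ} {κ : ℝ} (hκ0 : 0 ≤ κ) (hκ1 : κ < 1)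
    (hs : ∀ k, 0 ≤ s k) (hrec : ∀ k, s (k + 1) ≤ κ * s k + ε k)
    (hε : Tendsto ε atTop (𝓝 0)) : Tendsto s atTop (𝓝 0) := by
  refine tendsto_order.2 ⟨fun a ha => Eventually.of_forall fun k => ha.trans_le (hs k),
    fun δ hδ => ?_⟩
  obtain ⟨N, hN⟩ := ((tendsto_order.1 hε).2 (δ / 2 * (1 - κ))
    (mul_pos (by positivity) (by linarith))).exists_forall_of_atTop
  have hind : ∀ j, s (N + j) ≤ δ / 2 + κ ^ j * s N := by
    intro j
    induction j with
    | zero => simp; positivity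
    | succ j ih =>
      have h1 := hrec (N + j)
      have h2 := hN (N + j) (by omega)
      have h3 := mul_le_mul_of_nonneg_left ih hκ0
      rw [← add_assoc, pow_succ]
      linarith
  have hpow : Tendsto (fun j => δ / 2 + κ ^ j * s N) atTop (𝓝 (δ / 2)) := by
    simpa using ((tendsto_pow_atTop_nhds_zero_of_lt_one hκ0 hκ1).mul_const (s N)).const_add (δ / 2)
  obtain ⟨J, hJ⟩ := (hpow.eventually (gt_mem_nhds (half_lt_self hδ))).exists_forall_of_atTop
  filter_upwards [eventually_ge_atTop (N + J)] with k hk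
  obtain ⟨j, rfl⟩ := Nat.exists_eq_add_of_le (show N ≤ k by omega)
  exact (hind j).trans_lt (hJ j (by omega))

end Reduction

/-! ### Local boundedness of the inverse of `M + T` -/

section LocalBoundedness

open ContinuousLinearMap (adjoint adjoint_inner_left adjoint_inner_right)

variable {H : Type*} [NormedAddCommGroup H] [InnerProductSpace ℝ H] [CompleteSpace H]
variable {T : H → Set H} {M : H →L[ℝ] H} {f : H → H}

/-- If `(M + T)⁻¹` is single-valued and continuous on its domain, the domain contains a ball
around `M z₀` for every zero `z₀` of `T`, and `(M + T)⁻¹` is bounded on it. Solutions of the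
regularised inclusions `v + ε z₀ ∈ (M + ε + T) z` stay bounded by continuity, and a weak cluster
point of them solves `v ∈ (M + T) z`. -/
lemma exists_ball_subset_dom (hT : IsMaximalMonotoneOp T) (hM : M.IsPositive)
    (hf : ∀ v ∈ dom (inv (addOp M T)), inv (addOp M T) v = {f v})
    (hfc : ContinuousOn f (dom (inv (addOp M T)))) {z₀ : H} (hz₀ : z₀ ∈ inv T 0) :
    ∃ r > 0, ∀ v, ‖v - M z₀‖ ≤ r → v - M (f v) ∈ T (f v) ∧ ‖f v‖ ≤ ‖z₀‖ + 1 := by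
  have hval : ∀ v z, v - M z ∈ T z → v ∈ dom (inv (addOp M T)) ∧ z = f v := by
    intro v z hz
    have h1 : z ∈ inv (addOp M T) v := mem_inv_addOp.2 hz
    have h2 : v ∈ dom (inv (addOp M T)) := ⟨z, h1⟩
    exact ⟨h2, by rwa [hf v h2] at h1⟩
  obtain ⟨hd₀, hz₀f⟩ := hval (M z₀) z₀ (by rw [sub_self]; exact hz₀)
  obtain ⟨δ, hδ, hloc⟩ := Metric.continuousWithinAt_iff.1 (hfc _ hd₀) 1 one_pos
  have hloc' : ∀ v ∈ dom (inv (addOp M T)), ‖v - M z₀‖ < δ → ‖f v‖ ≤ ‖z₀‖ + 1 := by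
    intro v hv hlt
    have h1 := hloc hv (by rwa [dist_eq_norm])
    rw [dist_eq_norm, ← hz₀f] at h1
    linarith [norm_le_of_norm_sub_le h1.le]
  refine ⟨δ / 4, by positivity, fun v hv => ?_⟩
  have hsol : v ∈ dom (inv (addOp M T)) := by
    choose z hz using fun n : ℕ => hT.exists_regularized hM
      (Nat.one_div_pos_of_nat (α := ℝ) (n := n)) (v + (1 / ((n : ℝ) + 1)) • z₀)
    have hz' : ∀ n, v - (1 / ((n : ℝ) + 1)) • (z n - z₀) - M (z n) ∈ T (z n) := by
      intro n
      convert hz n using 1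
      rw [smul_sub]
      abel
    have hest : ∀ n : ℕ, ‖(1 / ((n : ℝ) + 1)) • (z n - z₀)‖ ≤ ‖v - M z₀‖ := by
      intro n
      have hn : 0 < 1 / ((n : ℝ) + 1) := Nat.one_div_pos_of_nat
      set c := 1 / ((n : ℝ) + 1)
      have h1 := hT.1 (hz' n) hz₀
      have h2 : 0 ≤ inner ℝ (M (z n - z₀)) (z n - z₀) := hM.inner_nonneg_left _
      set d := z n - z₀ with hd
      have e : v - c • d - M (z n) - 0 = (v - M z₀) - c • d - M d := by
        rw [hd, map_sub]; abel
      rw [e, inner_sub_left, inner_sub_left, real_inner_smul_left,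
        real_inner_self_eq_norm_sq] at h1
      have h3 := real_inner_le_norm (v - M z₀) d
      rw [norm_smul, Real.norm_of_nonneg hn.le]
      rcases (norm_nonneg d).eq_or_lt with h0 | h0
      · rw [← h0, mul_zero]; exact norm_nonneg _
      · refine le_of_mul_le_mul_right ?_ h0
        nlinarith
    have hbd : ∀ n, ‖z n‖ ≤ ‖z₀‖ + 1 := by
      intro n
      obtain ⟨h1, h2⟩ := hval _ _ (hz' n)
      rw [h2]
      refine hloc' _ h1 ?_
      have e : v - (1 / ((n : ℝ) + 1)) • (z n - z₀) - M z₀ =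
          (v - M z₀) - (1 / ((n : ℝ) + 1)) • (z n - z₀) := by abel
      rw [e]
      linarith [norm_sub_le (v - M z₀) ((1 / ((n : ℝ) + 1)) • (z n - z₀)), hest n]
    have hlim : Tendsto (fun n : ℕ => v - (1 / ((n : ℝ) + 1)) • (z n - z₀)) atTop (𝓝 v) := by
      have h0 : Tendsto (fun n : ℕ => (1 / ((n : ℝ) + 1)) • (z n - z₀)) atTop (𝓝 0) := by
        refine squeeze_zero_norm (a := fun n : ℕ => 1 / ((n : ℝ) + 1) * (‖z₀‖ + 1 + ‖z₀‖))
          (fun n => ?_) (by simpa using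
            tendsto_one_div_add_atTop_nhds_zero_nat.mul_const (‖z₀‖ + 1 + ‖z₀‖))
        rw [norm_smul, Real.norm_of_nonneg (Nat.one_div_pos_of_nat).le]
        refine mul_le_mul_of_nonneg_left ?_ (Nat.one_div_pos_of_nat).le
        linarith [norm_sub_le (z n) z₀, hbd n]
      simpa using h0.const_sub v
    obtain ⟨q, hq⟩ := exists_weakLim_of_bounded (hyperfilter ℕ) hbd
    exact (hval v q (hT.sub_mem_of_weakLim hM hbd hq
      (hlim.mono_left Nat.hyperfilter_le_atTop) hz')).1
  refine ⟨mem_inv_addOp.1 ?_, hloc' v hsol (by linarith)⟩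
  rw [hf v hsol]
  rfl

variable {U : Type*} [NormedAddCommGroup U] [InnerProductSpace ℝ U] [CompleteSpace U]

/-- Points `z u` of `(M + T)⁻¹ (C u)` remain bounded as long as `u` and `C* (z u)` do: the
monotonicity of `(M + T)⁻¹` against the values on a ball around `M z₀` bounds `⟪h, z u⟫` for all
small `h`. -/
lemma exists_norm_le_of_bounded (hT : IsMaximalMonotoneOp T) {C : U →L[ℝ] H}
    (hMC : M = C ∘L adjoint C) (hM : M.IsPositive)
    (hf : ∀ v ∈ dom (inv (addOp M T)), inv (addOp M T) v = {f v})
    (hfc : ContinuousOn f (dom (inv (addOp M T)))) {z₀ : H} (hz₀ : z₀ ∈ inv T 0) (R R' : ℝ) :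
    ∃ B, ∀ u z, C u - M z ∈ T z → ‖u‖ ≤ R → ‖adjoint C z‖ ≤ R' → ‖z‖ ≤ B := by
  obtain ⟨r, hr, hball⟩ := exists_ball_subset_dom hT hM hf hfc hz₀
  set K : ℝ := (‖M z₀‖ + r + ‖C‖ * R) * (‖z₀‖ + 1) + (‖adjoint C z₀‖ + R) * R' with hK
  refine ⟨max (K / r) 0, fun u z hz hu hu' => ?_⟩
  rcases (norm_nonneg z).eq_or_lt with h0 | h0
  · rw [← h0]; exact le_max_right _ _
  refine le_max_of_le_left ?_
  rw [le_div_iff₀ hr]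
  -- test direction of norm `r`
  set h : H := (r / ‖z‖) • z with hh
  have hnorm : ‖h‖ = r := by
    rw [hh, norm_smul, Real.norm_of_nonneg (by positivity), div_mul_cancel₀ _ h0.ne']
  obtain ⟨hv, hfv⟩ := hball (M z₀ + h) (by rw [add_sub_cancel_left, hnorm])
  set v := M z₀ + h with hvdef
  have h1 := hT.1 hv hz
  have h2 : 0 ≤ inner ℝ (M (f v - z)) (f v - z) := hM.inner_nonneg_left _
  have e1 : v - M (f v) - (C u - M z) = (v - C u) - M (f v - z) := by rw [map_sub]; abel
  rw [e1, inner_sub_left, inner_sub_right (v - C u)] at h1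
  have h3 : inner ℝ (v - C u) z = r * ‖z‖ + inner ℝ (adjoint C z₀ - u) (adjoint C z) := by
    have e2 : v - C u = h + C (adjoint C z₀ - u) := by
      rw [hvdef, hMC, map_sub, ContinuousLinearMap.comp_apply]; abel
    rw [e2, inner_add_left, ← adjoint_inner_right C, hh, real_inner_smul_left,
      real_inner_self_eq_norm_sq]
    field_simp
  have hR : 0 ≤ R := (norm_nonneg _).trans hu
  have h4 : inner ℝ (v - C u) (f v) ≤ (‖M z₀‖ + r + ‖C‖ * R) * (‖z₀‖ + 1) := by
    refine (real_inner_le_norm _ _).trans (mul_le_mul ?_ hfv (norm_nonneg _) (by positivity))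
    refine (norm_sub_le _ _).trans (add_le_add ?_ ?_)
    · exact (norm_add_le _ _).trans (by rw [hnorm])
    · exact (C.le_opNorm u).trans (mul_le_mul_of_nonneg_left hu (norm_nonneg _))
  have h5 : -inner ℝ (adjoint C z₀ - u) (adjoint C z) ≤ (‖adjoint C z₀‖ + R) * R' := by
    rw [← inner_neg_left]
    refine (real_inner_le_norm _ _).trans (mul_le_mul ?_ hu' (norm_nonneg _) (by positivity))
    rw [norm_neg]
    exact (norm_sub_le _ _).trans (by linarith)
  rw [hK]
  linarith

end LocalBoundedness

end DPPM

/-! ### The accelerated degenerate proximal point method -/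

open ContinuousLinearMap (adjoint)

theorem mainTheorem2
    {H : Type*} [NormedAddCommGroup H] [InnerProductSpace ℝ H] [CompleteSpace H]
    {U : Type*} [NormedAddCommGroup U] [InnerProductSpace ℝ U] [CompleteSpace U]
    (T : H → Set H) (hT : DPPM.IsMaximalMonotoneOp T) (hzero : (DPPM.inv T 0).Nonempty)
    (M : H →L[ℝ] H) (hM : DPPM.IsAdmissible M T) (hrange : IsClosed (Set.range M))
    (hcont : DPPM.IsContinuousOp (DPPM.inv (DPPM.addOp M T)))
    (C : U →L[ℝ] H) (hCinj : Function.Injective C)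
    (hMC : M = C ∘L ContinuousLinearMap.adjoint C)
    (α ρ : ℝ) (hα : 2 ≤ α) (hρ : ρ ∈ Set.Ioc (0 : ℝ) 2)
    (w wbar what : ℕ → H) (halg : DPPM.IsAccDPPM M T α ρ w wbar what) :
    (IsClosed (ContinuousLinearMap.adjoint C '' DPPM.inv T 0) ∧
      Convex ℝ (ContinuousLinearMap.adjoint C '' DPPM.inv T 0)) ∧
    (α = 2 →
      ∃ (p : U) (wstar : H),
        DPPM.IsProjOnto (ContinuousLinearMap.adjoint C '' DPPM.inv T 0)
          (ContinuousLinearMap.adjoint C (w 0)) p ∧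
        DPPM.inv (DPPM.addOp M T) (C p) = {wstar} ∧
        DPPM.hatT M T wstar = {wstar} ∧
        wstar ∈ DPPM.inv T 0 ∧
        Tendsto wbar atTop (𝓝 wstar) ∧
        (ρ < 2 → Tendsto w atTop (𝓝 wstar) ∧ Tendsto what atTop (𝓝 wstar))) ∧
    (2 < α →
      ∃ winf : H, DPPM.hatT M T winf = {winf} ∧ winf ∈ DPPM.inv T 0 ∧
        DPPM.WeaklyConvergesTo wbar winf) := by
  obtain ⟨hMpos, hMsv⟩ := hM
  obtain ⟨f, hf, hfc⟩ := hcont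
  obtain ⟨hρ0, hρ2⟩ := hρ
  have hMapp : ∀ z, M z = C (adjoint C z) := fun z => by rw [hMC]; rfl
  have hsurj : Function.Surjective (adjoint C) :=
    DPPM.adjoint_surjective C hCinj (by rw [← hMC]; exact hrange)
  have hdom : ∀ u, C u ∈ DPPM.dom (DPPM.inv (DPPM.addOp M T)) := by
    intro u
    obtain ⟨z, rfl⟩ := hsurj u
    rw [← hMapp]
    exact (hMsv z).exists
  have hsub : ∀ u z, C (u - adjoint C z) = C u - M z := fun u z => by rw [map_sub, hMapp]
  set g : U → H := fun u => f (C u) with hgdef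
  have hgval : ∀ u, DPPM.inv (DPPM.addOp M T) (C u) = {g u} := fun u => hf _ (hdom u)
  have hg : ∀ u, C (u - adjoint C (g u)) ∈ T (g u) := by
    intro u
    rw [hsub, ← DPPM.mem_inv_addOp, hgval]
    rfl
  have huniq : ∀ u z, C (u - adjoint C z) ∈ T z → z = g u := by
    intro u z hz
    rw [hsub, ← DPPM.mem_inv_addOp, hgval] at hz
    exact hz
  have hgc : Continuous g := hfc.comp_continuous C.continuous hdom
  set Q := DPPM.residual C g ρ with hQdef
  have hQ : DPPM.IsHalfCocoercive Q := DPPM.isHalfCocoercive_residual hT.1 hg hρ0.le hρ2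
  have hzeros : {u | Q u = 0} = adjoint C '' DPPM.inv T 0 := DPPM.zeros_residual hg huniq hρ0
  have hclosed : IsClosed (adjoint C '' DPPM.inv T 0) := hzeros ▸ hQ.isClosed_zeros
  have hconvex : Convex ℝ (adjoint C '' DPPM.inv T 0) := hzeros ▸ hQ.convex_zeros
  have hfixed : ∀ p, Q p = 0 → DPPM.hatT M T (g p) = {g p} := by
    intro p hp
    unfold DPPM.hatT
    rw [hMapp, (DPPM.residual_eq_zero_iff hρ0).1 hp]
    exact hgval p
  have hwbar : ∀ k, wbar k = g (adjoint C (w k)) := by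
    intro k
    have h := halg.step1 k
    unfold DPPM.hatT at h
    rw [hMapp, hgval] at h
    exact h
  have hα0 : 0 < α := by linarith
  have hiter : DPPM.IsMomentumIter Q α (fun k => adjoint C (w k)) _ :=
    DPPM.isMomentumIter_of_accelerated (xhat := fun k => adjoint C (what k)) hα0
      (fun k => by
        rw [halg.step2 k, hwbar k, hQdef, map_add, map_smul, map_smul]
        unfold DPPM.residual
        module)
      (fun k => by
        rw [halg.step3 k, map_add, map_add, map_smul, map_smul, map_sub, map_sub])
  refine ⟨⟨hclosed, hconvex⟩, fun hα2 => ?_, fun hα2 => ?_⟩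
  · subst hα2
    obtain ⟨p, hpP, hpvar⟩ := DPPM.exists_isProjOnto (hzero.image _) hclosed hconvex
      (adjoint C (w 0))
    have hp : Q p = 0 := by
      have := hpP.1
      rwa [← hzeros] at this
    have hx := hiter.tendsto_halpern hQ hp fun q hq => hpvar q (hzeros ▸ hq)
    have hwb : Tendsto wbar atTop (𝓝 (g p)) :=
      ((hgc.tendsto p).comp hx).congr fun k => (hwbar k).symm
    refine ⟨p, g p, hpP, hgval p, hfixed p hp, DPPM.mem_zeros_of_residual_eq_zero hg hρ0 hp, hwb,
      fun hρlt => ?_⟩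
    -- the iteration in `H` is of Halpern form too, with the operator `ρ (id - f M)`
    have hstep : ∀ k, what (k + 1) = w k - ρ • (w k - f (M (w k))) := by
      intro k
      rw [halg.step2 k, hwbar k, hgdef, hMapp]
      module
    have hiterH : DPPM.IsMomentumIter (fun h => ρ • (h - f (M h))) 2 w _ :=
      DPPM.isMomentumIter_of_accelerated two_pos hstep halg.step3
    have hw : Tendsto w atTop (𝓝 (g p)) := by
      rw [tendsto_iff_norm_sub_tendsto_zero]
      refine DPPM.tendsto_zero_of_contraction (κ := |1 - ρ|)
        (ε := fun k => 1 / ((k : ℝ) + 1) * ‖w 0 - g p‖ + ρ * ‖wbar k - g p‖)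
        (abs_nonneg _) (abs_lt.2 ⟨by linarith, by linarith⟩) (fun k => norm_nonneg _)
        (fun k => ?_) ?_
      · have hk2 : (0 : ℝ) < (k : ℝ) + 2 := by positivity
        have h1 : w (k + 1) - g p = ((k : ℝ) + 2)⁻¹ • (w 0 - g p) +
            (((k : ℝ) + 1) / ((k : ℝ) + 2)) • ((1 - ρ) • (w k - g p) + ρ • (wbar k - g p)) := by
          have h3 : ((k : ℝ) + 2)⁻¹ = 1 - ((k : ℝ) + 1) / ((k : ℝ) + 2) := by
            field_simp; ring
          have h4 : f (M (w k)) = wbar k := by rw [hwbar k, hgdef, hMapp]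
          rw [hiterH.halpern k, h3, h4]
          module
        have hc : ((k : ℝ) + 1) / ((k : ℝ) + 2) ≤ 1 := by
          rw [div_le_one hk2]; linarith
        have hc' : ((k : ℝ) + 2)⁻¹ ≤ 1 / ((k : ℝ) + 1) := by
          rw [inv_eq_one_div]
          exact one_div_le_one_div_of_le (by positivity) (by linarith)
        rw [h1]
        calc _ ≤ ‖((k : ℝ) + 2)⁻¹ • (w 0 - g p)‖ + ‖(((k : ℝ) + 1) / ((k : ℝ) + 2)) •
              ((1 - ρ) • (w k - g p) + ρ • (wbar k - g p))‖ := norm_add_le _ _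
          _ ≤ 1 / ((k : ℝ) + 1) * ‖w 0 - g p‖ +
              ‖(1 - ρ) • (w k - g p) + ρ • (wbar k - g p)‖ := by
            rw [norm_smul, norm_smul, Real.norm_of_nonneg (by positivity),
              Real.norm_of_nonneg (by positivity)]
            exact add_le_add (mul_le_mul_of_nonneg_right hc' (norm_nonneg _))
              (mul_le_of_le_one_left (norm_nonneg _) hc)
          _ ≤ 1 / ((k : ℝ) + 1) * ‖w 0 - g p‖ +
              (|1 - ρ| * ‖w k - g p‖ + ρ * ‖wbar k - g p‖) := by
            refine add_le_add le_rfl ((norm_add_le _ _).trans (le_of_eq ?_))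
            rw [norm_smul, norm_smul, Real.norm_eq_abs, Real.norm_of_nonneg hρ0.le]
          _ = _ := by ring
      · have h1 : Tendsto (fun k : ℕ => 1 / ((k : ℝ) + 1) * ‖w 0 - g p‖) atTop (𝓝 0) := by
          simpa using tendsto_one_div_add_atTop_nhds_zero_nat.mul_const ‖w 0 - g p‖
        have h2 := (tendsto_iff_norm_sub_tendsto_zero.1 hwb).const_mul ρ
        simpa using h1.add h2
    refine ⟨hw, (tendsto_add_atTop_iff_nat 1).1 ?_⟩
    have h1 := (hw.const_smul (1 - ρ)).add (hwb.const_smul ρ)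
    rw [← add_smul, sub_add_cancel, one_smul] at h1
    exact h1.congr fun k => (halg.step2 k).symm
  · obtain ⟨z₀, hz₀⟩ := hzero
    have hp₀ : Q (adjoint C z₀) = 0 := by
      have : adjoint C z₀ ∈ {u | Q u = 0} := hzeros ▸ ⟨z₀, hz₀, rfl⟩
      exact this
    obtain ⟨⟨R, hR⟩, hQ0, q, hq, hxq⟩ := hiter.exists_weakLim hQ hp₀ hα2
    refine ⟨g q, hfixed q hq, DPPM.mem_zeros_of_residual_eq_zero hg hρ0 hq,
      DPPM.weaklyConvergesTo_of_weakLim ?_⟩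
    have hCw : ∀ k, adjoint C (wbar k) = adjoint C (w k) + (-ρ⁻¹) • Q (adjoint C (w k)) := by
      intro k
      rw [hwbar k, hQdef]
      unfold DPPM.residual
      rw [smul_smul, neg_mul, inv_mul_cancel₀ hρ0.ne']
      module
    have hscaled : Tendsto (fun k => (-ρ⁻¹) • Q (adjoint C (w k))) atTop (𝓝 0) := by
      simpa using hQ0.const_smul (-ρ⁻¹)
    have hmem : ∀ k, C (adjoint C (w k)) - M (wbar k) ∈ T (wbar k) := by
      intro k
      rw [← hsub, hwbar k]
      exact hg _
    obtain ⟨B, hB⟩ : ∃ B, ∀ k, ‖wbar k‖ ≤ B := by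
      obtain ⟨S, hS⟩ := DPPM.exists_bound_of_tendsto hscaled.norm
      obtain ⟨B, hB⟩ := DPPM.exists_norm_le_of_bounded hT hMC hMpos hf hfc hz₀ R (R + S)
      refine ⟨B, fun k => hB _ _ (hmem k) (hR k) ?_⟩
      rw [hCw]
      exact (norm_add_le _ _).trans (add_le_add (hR k) (hS k))
    refine DPPM.weakLim_of_ultrafilter fun G hG => ?_
    obtain ⟨z, hz⟩ := DPPM.exists_weakLim_of_bounded G hB
    have hCz : adjoint C z = q := by
      refine (hz.map (adjoint C)).unique ?_
      simp only [hCw]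
      simpa using (hxq.mono hG).add_strong (hscaled.mono_left hG)
    have hTz : (0 : H) ∈ T z := by
      have hlim : Tendsto (fun k => C (adjoint C (w k)) - M (wbar k)) G (𝓝 0) := by
        have h0 := hscaled.neg.mono_left hG
        rw [neg_zero] at h0
        have h1 := (C.continuous.tendsto 0).comp h0
        rw [map_zero] at h1
        refine h1.congr fun k => ?_
        rw [hMapp, ← map_sub, hCw]
        simp
      have h2 := hT.sub_mem_of_weakLim (M := 0) (ContinuousLinearMap.isPositive_zero) hB hz hlim
        (fun k => by simpa using hmem k)
      simpa using h2
    have : z = g q := huniq q z (by rw [hCz, sub_self, map_zero]; exact hTz)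
    exact this ▸ hz
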